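/- Let $N\ge 3$, let $\Omega\subset\mathbb{R}^N$ be a bounded open set, and let $1<p<N$, $q>0$, $\mu>0$ and $k>\frac Np$ be real numbers. Let $W_0^{1,p}(\Omega)$ be the closure of $C_c^\infty(\Omega)$ in $W^{1,p}(\Omega)$, with the norm $\|v\|=\left(\int_\Omega|\nabla v|^p\right)^{1/p}$. Put $$g(s)=\frac{(p-1)^{q-p+1}}{\mu^{q}}(1+\mu s)^{p-1}|\ln(1+\mu s)|^{q-1}\ln(1+\mu s),\qquad f(s)=\frac{(1+\mu s)^{p-1}}{(p-1)^{p-1}}\qquad\text{for } s>-\tfrac1\mu$$ (with $g(0)=0$), and $g(s)=f(s)=0$ for $s\le-\frac1\mu$; let $G(s)=\int_0^s g(t)\,dt$ and $F(s)=\int_0^s f(t)\,dt$. For $c,h\in L^k(\Omega)$ define on $W_0^{1,p}(\Omega)$ $$I(v)=\frac1p\int_\Omega|\nabla v|^p-\int_\Omega c(x)G(v)-\int_\Omega h(x)F(v).$$ Then there is $\delta>0$, depending only on $N,\Omega,p,q,\mu,k$, such that the following holds for all $c,h\in L^k(\Omega)$ with $c\ge 0$ a.e., $c\not\equiv 0$,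 $\|c\|_k\le\delta$ and $\|h\|_k\le\delta$ ($h$ may change sign). Let $v_0\in W_0^{1,p}(\Omega)$ be such that for some $\rho>0$ and $\beta>0$ one has $I(v)\ge\beta$ whenever $\|v\|=\rho$, while $\|v_0\|>\rho$ and $I(v_0)\le 0$, and let $$\tilde c=\inf_{\gamma\in\Gamma}\max_{t\in[0,1]}I(\gamma(t)),\qquad \Gamma=\{\gamma\in C([0,1],W_0^{1,p}(\Omega)):\gamma(0)=0,\ \gamma(1)=v_0\}.$$ Call $(u_n)$ in $W_0^{1,p}(\Omega)$ a Palais–Smale sequence of $I$ at the level $\tilde c$ if $I(u_n)\to\tilde c$ and $\|I'(u_n)\|_{*}\to0$, where $I'$ is the Fréchet derivative and $\|\cdot\|_*$ is the dual norm. Then: (1) every Palais–Smale sequence of $I$ at the level $\tilde c$ is bounded in $W_0^{1,p}(\Omega)$; (2) every Palais–Smale sequence of $I$ at the level $\tilde c$ has a subsequence that converges strongly in $W_0^{1,p}(\Omega)$; that is, $I$ satisfies the Palais–Smale condition at the level $\tilde c$. -/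

import Mathlib

open MeasureTheory Filter Topology
open scoped ContDiff ENNReal

noncomputable section

/-! ### The space `W₀^{1,p}(Ω)` -/

instance factOneLeOfReal {p : ℝ} [hp : Fact (1 < p)] : Fact (1 ≤ ENNReal.ofReal p) :=
  ⟨ENNReal.one_le_ofReal.2 hp.out.le⟩

/-- Test functions: smooth functions on `ℝ^N` with compact support contained in `Ω`. -/
structure IsTestFunction {N : ℕ} (Ω : Set (EuclideanSpace ℝ (Fin N)))
    (φ : EuclideanSpace ℝ (Fin N) → ℝ) : Prop where
  contDiff : ContDiff ℝ ∞ φ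
  hasCompactSupport : HasCompactSupport φ
  tsupport_subset : tsupport φ ⊆ Ω

/-- The linear space of all pairs `(φ, ∇φ)` in `L^p(Ω) × L^p(Ω; ℝ^N)`, where `φ` is a test
function. -/
def testPairs {N : ℕ} (Ω : Set (EuclideanSpace ℝ (Fin N))) (p : ℝ) [Fact (1 < p)] :
    Submodule ℝ (Lp ℝ (ENNReal.ofReal p) (volume.restrict Ω) ×
      Lp (EuclideanSpace ℝ (Fin N)) (ENNReal.ofReal p) (volume.restrict Ω)) where
  carrier := {w | ∃ φ : EuclideanSpace ℝ (Fin N) → ℝ, IsTestFunction Ω φ ∧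
    (w.1 : EuclideanSpace ℝ (Fin N) → ℝ) =ᵐ[volume.restrict Ω] φ ∧
    (w.2 : EuclideanSpace ℝ (Fin N) → EuclideanSpace ℝ (Fin N)) =ᵐ[volume.restrict Ω]
      gradient φ}
  add_mem' := by
    rintro a b ⟨φ, hφ, h1, h2⟩ ⟨ψ, hψ, k1, k2⟩
    refine ⟨φ + ψ, ⟨hφ.contDiff.add hψ.contDiff,
      hφ.hasCompactSupport.add hψ.hasCompactSupport,
      (tsupport_add φ ψ).trans (Set.union_subset hφ.tsupport_subset hψ.tsupport_subset)⟩,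
      ?_, ?_⟩
    · filter_upwards [Lp.coeFn_add a.1 b.1, h1, k1] with x hx e1 e2
      simp only [Prod.fst_add, hx, Pi.add_apply, e1, e2]
    · filter_upwards [Lp.coeFn_add a.2 b.2, h2, k2] with x hx e1 e2
      simp only [Prod.snd_add, hx, Pi.add_apply, e1, e2]
      have d1 : DifferentiableAt ℝ φ x := (hφ.contDiff.differentiable (by simp)) x
      have d2 : DifferentiableAt ℝ ψ x := (hψ.contDiff.differentiable (by simp)) x
      simp only [gradient, fderiv_add d1 d2, map_add]
  zero_mem' := by
    refine ⟨0, ⟨contDiff_const, HasCompactSupport.zero, by simp⟩, ?_, ?_⟩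
    · exact Lp.coeFn_zero _ _ _
    · filter_upwards [Lp.coeFn_zero (EuclideanSpace ℝ (Fin N)) (ENNReal.ofReal p)
        (volume.restrict Ω)] with x hx
      have e : gradient (0 : EuclideanSpace ℝ (Fin N) → ℝ) x = 0 := by simp [gradient]
      rw [e]
      exact hx
  smul_mem' := by
    rintro r a ⟨φ, hφ, h1, h2⟩
    refine ⟨r • φ, ⟨hφ.contDiff.const_smul r, hφ.hasCompactSupport.smul_left,
      (closure_mono (Function.support_const_smul_subset r φ)).trans hφ.tsupport_subset⟩, ?_, ?_⟩
    · filter_upwards [Lp.coeFn_smul r a.1, h1] with x hx e1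
      simp only [Prod.smul_fst, hx, Pi.smul_apply, e1]
    · filter_upwards [Lp.coeFn_smul r a.2, h2] with x hx e1
      have d1 : DifferentiableAt ℝ φ x := (hφ.contDiff.differentiable (by simp)) x
      simp only [Prod.smul_snd, hx, Pi.smul_apply, e1]
      simp only [gradient, fderiv_const_smul d1, map_smul]

/-- `W₀^{1,p}(Ω)`: the closure of the test functions with respect to the `W^{1,p}` norm. Its
elements are pairs `(v, ∇v)`, a function in `L^p(Ω)` with its weak gradient in `L^p(Ω; ℝ^N)`. -/
def W0 {N : ℕ} (Ω : Set (EuclideanSpace ℝ (Fin N))) (p : ℝ) [Fact (1 < p)] : Type :=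
  ↥((testPairs Ω p).topologicalClosure)

namespace W0

variable {N : ℕ} {Ω : Set (EuclideanSpace ℝ (Fin N))} {p : ℝ} [Fact (1 < p)]

instance : AddCommGroup (W0 Ω p) :=
  inferInstanceAs (AddCommGroup ↥((testPairs Ω p).topologicalClosure))

instance : Module ℝ (W0 Ω p) :=
  inferInstanceAs (Module ℝ ↥((testPairs Ω p).topologicalClosure))

/-- The function underlying an element of `W₀^{1,p}(Ω)`. -/
def toLp : W0 Ω p →ₗ[ℝ] Lp ℝ (ENNReal.ofReal p) (volume.restrict Ω) :=
  LinearMap.fst ℝ _ _ ∘ₗ ((testPairs Ω p).topologicalClosure).subtype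

/-- The weak gradient of an element of `W₀^{1,p}(Ω)`. -/
def grad : W0 Ω p →ₗ[ℝ]
    Lp (EuclideanSpace ℝ (Fin N)) (ENNReal.ofReal p) (volume.restrict Ω) :=
  LinearMap.snd ℝ _ _ ∘ₗ ((testPairs Ω p).topologicalClosure).subtype

instance : CoeFun (W0 Ω p) (fun _ => EuclideanSpace ℝ (Fin N) → ℝ) :=
  ⟨fun v => toLp v⟩

/-- Poincaré's inequality. -/
theorem exists_norm_toLp_le [hpN : Fact (p < N)] [hb : Fact (Bornology.IsBounded Ω)] :
    ∃ C : ℝ, ∀ v : W0 Ω p, ‖toLp v‖ ≤ C * ‖grad v‖ := by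
  have hp1 : 1 < p := Fact.out
  have hpc : ENNReal.ofReal p = ((p.toNNReal : NNReal) : ℝ≥0∞) := rfl
  obtain ⟨C, hCdef⟩ : ∃ C : NNReal, C = eLpNormLESNormFDerivOfLeConst ℝ
    (volume : Measure (EuclideanSpace ℝ (Fin N))) Ω p.toNNReal p.toNNReal := ⟨_, rfl⟩
  refine ⟨C, fun v => ?_⟩
  have hclosed : IsClosed {w : Lp ℝ (ENNReal.ofReal p) (volume.restrict Ω) ×
      Lp (EuclideanSpace ℝ (Fin N)) (ENNReal.ofReal p) (volume.restrict Ω) |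
      ‖w.1‖ ≤ C * ‖w.2‖} :=
    isClosed_le continuous_fst.norm (continuous_const.mul continuous_snd.norm)
  suffices hsub : (testPairs Ω p : Set _) ⊆ {w : Lp ℝ (ENNReal.ofReal p) (volume.restrict Ω) ×
      Lp (EuclideanSpace ℝ (Fin N)) (ENNReal.ofReal p) (volume.restrict Ω) |
      ‖w.1‖ ≤ C * ‖w.2‖} from closure_minimal hsub hclosed v.2
  rintro w ⟨φ, hφ, h1, h2⟩
  have key := eLpNorm_le_eLpNorm_fderiv (volume : Measure (EuclideanSpace ℝ (Fin N)))
    (hφ.contDiff.of_le (by simp)) ((subset_tsupport φ).trans hφ.tsupport_subset)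
    (p := p.toNNReal) (by simpa using hp1.le) (by
      rw [finrank_euclideanSpace_fin, Real.toNNReal_lt_iff_lt_coe (by linarith)]
      simpa using hpN.out) hb.out
  rw [← hpc, ← hCdef] at key
  have e1 : eLpNorm (fderiv ℝ φ) (ENNReal.ofReal p) volume =
      eLpNorm (gradient φ) (ENNReal.ofReal p) (volume.restrict Ω) := by
    have hg : ∀ x, ‖fderiv ℝ φ x‖ = ‖gradient φ x‖ := fun x => by
      rw [gradient, LinearIsometryEquiv.norm_map]
    have hs : Function.support (gradient φ) ⊆ Ω := fun x hx => by
      refine hφ.tsupport_subset (tsupport_fderiv_subset ℝ (subset_tsupport _ ?_))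
      rw [Function.mem_support, ← norm_ne_zero_iff] at hx ⊢
      rwa [hg x]
    calc eLpNorm (fderiv ℝ φ) (ENNReal.ofReal p) volume
        = eLpNorm (gradient φ) (ENNReal.ofReal p) volume :=
          eLpNorm_congr_norm_ae (Eventually.of_forall hg)
      _ = eLpNorm (gradient φ) (ENNReal.ofReal p) (volume.restrict Ω) :=
          (eLpNorm_restrict_eq_of_support_subset hs).symm
  have key2 : eLpNorm w.1 (ENNReal.ofReal p) (volume.restrict Ω) ≤
      C * eLpNorm w.2 (ENNReal.ofReal p) (volume.restrict Ω) := by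
    calc eLpNorm w.1 (ENNReal.ofReal p) (volume.restrict Ω)
        = eLpNorm φ (ENNReal.ofReal p) (volume.restrict Ω) := eLpNorm_congr_ae h1
      _ ≤ eLpNorm φ (ENNReal.ofReal p) volume :=
          eLpNorm_mono_measure _ Measure.restrict_le_self
      _ ≤ C * eLpNorm (fderiv ℝ φ) (ENNReal.ofReal p) volume := key
      _ = C * eLpNorm w.2 (ENNReal.ofReal p) (volume.restrict Ω) := by
          rw [e1, eLpNorm_congr_ae h2]
  have key3 := ENNReal.toReal_mono
    (ENNReal.mul_ne_top ENNReal.coe_ne_top (Lp.eLpNorm_ne_top w.2)) key2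
  rw [ENNReal.toReal_mul, ENNReal.coe_toReal] at key3
  exact key3

theorem grad_injective [Fact (p < N)] [Fact (Bornology.IsBounded Ω)] :
    Function.Injective (grad : W0 Ω p →ₗ[ℝ] _) := by
  rw [injective_iff_map_eq_zero]
  intro v hv
  obtain ⟨C, hC⟩ := exists_norm_toLp_le (Ω := Ω) (p := p)
  have h1 : toLp v = 0 := by
    have := hC v
    rw [hv, norm_zero, mul_zero] at this
    exact norm_le_zero_iff.1 this
  exact Subtype.ext (Prod.ext h1 hv)

/-- The Poincaré norm `‖v‖ = (∫_Ω |∇v|^p)^{1/p}`. -/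
instance [Fact (p < N)] [Fact (Bornology.IsBounded Ω)] : NormedAddCommGroup (W0 Ω p) :=
  NormedAddCommGroup.induced (W0 Ω p) _ (grad : W0 Ω p →ₗ[ℝ] _) grad_injective

instance [Fact (p < N)] [Fact (Bornology.IsBounded Ω)] : NormedSpace ℝ (W0 Ω p) :=
  NormedSpace.induced ℝ (W0 Ω p) _ (grad : W0 Ω p →ₗ[ℝ] _)

end W0

/-! ### The nonlinearities and the functional -/

/-- `g(s) = (p-1)^{q-p+1} / μ^q * (1+μs)^{p-1} |ln(1+μs)|^{q-1} ln(1+μs)` for `s > -1/μ`, extended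
(continuously) by `0` to `s ≤ -1/μ`. -/
def gFun (p q μ s : ℝ) : ℝ :=
  if -1 / μ < s then
    (p - 1) ^ (q - p + 1) / μ ^ q * (1 + μ * s) ^ (p - 1) *
      |Real.log (1 + μ * s)| ^ (q - 1) * Real.log (1 + μ * s)
  else 0

/-- `f(s) = (1+μs)^{p-1} / (p-1)^{p-1}` for `s > -1/μ`, extended (continuously) by `0` to
`s ≤ -1/μ`. -/
def fFun (p μ s : ℝ) : ℝ :=
  if -1 / μ < s then (1 + μ * s) ^ (p - 1) / (p - 1) ^ (p - 1) else 0

/-- The primitive `G(s) = ∫₀^s g`. -/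
def GFun (p q μ s : ℝ) : ℝ := ∫ t in (0 : ℝ)..s, gFun p q μ t

/-- The primitive `F(s) = ∫₀^s f`. -/
def FFun (p μ s : ℝ) : ℝ := ∫ t in (0 : ℝ)..s, fFun p μ t

/-- `I(v) = (1/p) ∫_Ω |∇v|^p - ∫_Ω c G(v) - ∫_Ω h F(v)` on `W₀^{1,p}(Ω)`. -/
def energy {N : ℕ} (Ω : Set (EuclideanSpace ℝ (Fin N))) (p q μ : ℝ) [Fact (1 < p)]
    (c h : EuclideanSpace ℝ (Fin N) → ℝ) (v : W0 Ω p) : ℝ :=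
  1 / p * (∫ x in Ω, ‖W0.grad v x‖ ^ p) - (∫ x in Ω, c x * GFun p q μ (v x)) -
    ∫ x in Ω, h x * FFun p μ (v x)

/-! ### Mountain pass level and the Palais–Smale condition -/

section PalaisSmale

variable {E : Type*} [NormedAddCommGroup E] [NormedSpace ℝ E]

/-- `v₀` is an end point for the mountain pass geometry of `I` (around `0`): on some sphere
`‖v‖ = ρ` one has `I ≥ β > 0`, while `‖v₀‖ > ρ` and `I(v₀) ≤ 0`. -/
def IsMountainPassEndpoint (I : E → ℝ) (v₀ : E) : Prop :=
  ∃ ρ > 0, ∃ β > 0, (∀ v : E, ‖v‖ = ρ → β ≤ I v) ∧ ρ < ‖v₀‖ ∧ I v₀ ≤ 0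

/-- The level `inf_γ max_{t ∈ [0,1]} I(γ(t))`, over all continuous paths `γ` from `0` to `v₀`. -/
def mountainPassLevel (I : E → ℝ) (v₀ : E) : ℝ :=
  ⨅ γ : Path (0 : E) v₀, ⨆ t : unitInterval, I (γ t)

/-- `(u_n)` is a Palais–Smale sequence for `I` at the level `l`: `I(u_n) → l` and
`‖I'(u_n)‖_{E*} → 0`, where `I'` is the Fréchet derivative. -/
def IsPalaisSmaleSeq (I : E → ℝ) (l : ℝ) (u : ℕ → E) : Prop :=
  Tendsto (fun n => I (u n)) atTop (𝓝 l) ∧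
    (∀ n, DifferentiableAt ℝ I (u n)) ∧
    Tendsto (fun n => ‖fderiv ℝ I (u n)‖) atTop (𝓝 0)

/-- The Palais–Smale condition at the level `l`: every Palais–Smale sequence at the level `l` has a
(norm) convergent subsequence. -/
def PalaisSmaleCondition (I : E → ℝ) (l : ℝ) : Prop :=
  ∀ u : ℕ → E, IsPalaisSmaleSeq I l u →
    ∃ (w : E) (σ : ℕ → ℕ), StrictMono σ ∧ Tendsto (u ∘ σ) atTop (𝓝 w)

end PalaisSmale

end

noncomputable section

/-! The function g grows like s^(p-1) (ln s)^q, only a logarithm above the p-homogeneous rate, so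
the Ambrosetti–Rabinowitz condition fails and boundedness is the main difficulty. Write K = ‖u‖ and
H(s) = g(s)s/p - G(s).

Boundedness. In I(u) - I'(u)u/p the gradient terms cancel, leaving ∫ c H(u) plus an h-term. The
leading powers in f(s)s/p - F(s) also cancel, so that h-term has growth p-1 and ∫ c H(u) = O(K^a)
for K ≥ 1, with a = max(1, p-1) < p (`integral_weight_HFun_eq`, `exists_abs_fFun_mul_sub_le`). On
the other side H(s) + C dominates s₊^(p-η) for small η > 0 (`exists_le_HFun`), while G is at most of
order 1 + s₊^(p+η). Interpolating the power p+η between p-η and p+3η with a free parameter L, and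
using c ≥ 0, bounds ∫ c G(u) by a constant, a multiple of L^(2η) (K^a + 1), and a multiple of
L^(-2η) K^(p+3η). The choice L = K² makes both exponents, 4η + a and p - η, smaller than p. The term
∫ h F(u) has exact order K^p, but smallness of h keeps it below K^p/(2p) up to a constant.
Boundedness of I(u) then forces a bound on K (`exists_norm_le_of_energy_le`).

Compactness. By Rellich (`isCompactOperator_toLpL`) a bounded sequence has a subsequence that is
Cauchy in L^p. Tested on differences u_i - u_j, the lower order terms of I' are uniformly small
(`exists_abs_integral_mul_le`), because k > N/p leaves room below the critical Sobolev exponent.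
Since I'(u_n) → 0, the p-Laplacian pairing of u_i and u_j tends to 0, and a quantitative form of
strict monotonicity (`exists_norm_sub_rpow_le`) shows that the subsequence is Cauchy in the norm of
W₀^{1,p}. -/

theorem isFiniteMeasure_restrict {N : ℕ} {Ω : Set (EuclideanSpace ℝ (Fin N))}
    (hb : Bornology.IsBounded Ω) :
    IsFiniteMeasure (volume.restrict Ω) :=
  ⟨by rw [Measure.restrict_apply_univ]; exact hb.measure_lt_top⟩

theorem IsTestFunction.eLpNorm_fderiv_eq {N : ℕ} {Ω : Set (EuclideanSpace ℝ (Fin N))}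
    {φ : EuclideanSpace ℝ (Fin N) → ℝ}
    (hφ : IsTestFunction Ω φ) (r : ℝ≥0∞) :
    eLpNorm (fderiv ℝ φ) r volume = eLpNorm (gradient φ) r (volume.restrict Ω) := by
  have hg : ∀ x, ‖fderiv ℝ φ x‖ = ‖gradient φ x‖ := fun x => by
    rw [gradient, LinearIsometryEquiv.norm_map]
  have hs : Function.support (gradient φ) ⊆ Ω := fun x hx => by
    refine hφ.tsupport_subset (tsupport_fderiv_subset ℝ (subset_tsupport _ ?_))
    rw [Function.mem_support, ← norm_ne_zero_iff] at hx ⊢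
    rwa [hg x]
  rw [eLpNorm_restrict_eq_of_support_subset hs]
  exact eLpNorm_congr_norm_ae (Eventually.of_forall hg)

/-! ### Density, completeness and Sobolev inequalities in W₀^{1,p} -/

namespace W0

variable {N : ℕ} {Ω : Set (EuclideanSpace ℝ (Fin N))} {p : ℝ} [Fact (1 < p)]

/-- Density principle: a closed condition on pairs (v, ∇v) need only be checked on test functions.
-/
theorem induction_of_isClosed {S : Set (Lp ℝ (ENNReal.ofReal p) (volume.restrict Ω) ×
      Lp (EuclideanSpace ℝ (Fin N)) (ENNReal.ofReal p) (volume.restrict Ω))}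
    (hS : IsClosed S) (hsub : (testPairs Ω p : Set _) ⊆ S) (v : W0 Ω p) :
    (toLp v, grad v) ∈ S :=
  closure_minimal hsub hS v.2

theorem mem_closure_iff_exists
    (w : Lp ℝ (ENNReal.ofReal p) (volume.restrict Ω) ×
      Lp (EuclideanSpace ℝ (Fin N)) (ENNReal.ofReal p) (volume.restrict Ω)) :
    w ∈ closure (Set.range fun v : W0 Ω p => (toLp v, grad v)) ↔
      ∃ v : W0 Ω p, (toLp v, grad v) = w := by
  have hr : (Set.range fun v : W0 Ω p => (toLp v, grad v)) =
      ((testPairs Ω p).topologicalClosure : Set _) := by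
    ext w
    constructor
    · rintro ⟨v, rfl⟩
      exact v.2
    · intro hw
      exact ⟨⟨w, hw⟩, rfl⟩
  have hc : IsClosed (Set.range fun v : W0 Ω p => (toLp v, grad v)) := by
    rw [hr]
    exact (testPairs Ω p).isClosed_topologicalClosure
  rw [hc.closure_eq]
  rfl

variable [hpN : Fact (p < N)] [hb : Fact (Bornology.IsBounded Ω)]

theorem norm_eq (v : W0 Ω p) : ‖v‖ = ‖grad v‖ := rfl

/-- The inclusion of `W₀^{1,p}(Ω)` into `L^p(Ω)`. -/
def toLpL : W0 Ω p →L[ℝ] Lp ℝ (ENNReal.ofReal p) (volume.restrict Ω) :=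
  LinearMap.mkContinuousOfExistsBound toLp exists_norm_toLp_le

@[simp]
theorem toLpL_apply (v : W0 Ω p) : toLpL v = toLp v := rfl

instance : CompleteSpace (W0 Ω p) := by
  refine Metric.complete_of_cauchySeq_tendsto fun u hu => ?_
  have hg : CauchySeq fun n => grad (u n) := by
    rw [Metric.cauchySeq_iff] at hu ⊢
    intro ε hε
    obtain ⟨n, hn⟩ := hu ε hε
    refine ⟨n, fun i hi j hj => ?_⟩
    have := hn i hi j hj
    rwa [dist_eq_norm, norm_eq, map_sub, ← dist_eq_norm] at this
  -- The norm sees only gradients; Poincaré's inequality makes the functions Cauchy too, so the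
  -- pairs converge, and the space of pairs is closed.
  have hl : CauchySeq fun n => toLp (u n) :=
    (toLpL (Ω := Ω) (p := p)).uniformContinuous.comp_cauchySeq hu
  obtain ⟨a, ha⟩ := cauchySeq_tendsto_of_complete hl
  obtain ⟨b, hb⟩ := cauchySeq_tendsto_of_complete hg
  obtain ⟨v, hv⟩ := (mem_closure_iff_exists (a, b)).1
    (mem_closure_of_tendsto (ha.prodMk_nhds hb) (Eventually.of_forall fun n => ⟨u n, rfl⟩))
  refine ⟨v, ?_⟩
  obtain ⟨-, rfl⟩ := Prod.mk.inj hv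
  rw [tendsto_iff_norm_sub_tendsto_zero] at hb ⊢
  exact hb.congr fun n => by rw [norm_eq, map_sub]

/-- The Sobolev inequality for all subcritical and critical exponents. -/
theorem exists_eLpNorm_le {t : ℝ} (ht : 0 < t) (htp : 1 / p - 1 / N ≤ 1 / t) :
    ∃ C : ℝ, 0 ≤ C ∧ ∀ v : W0 Ω p,
      eLpNorm v (ENNReal.ofReal t) (volume.restrict Ω) ≤ ENNReal.ofReal (C * ‖v‖) := by
  have hp1 : 1 < p := Fact.out
  obtain ⟨C, hCdef⟩ : ∃ C : NNReal, C = eLpNormLESNormFDerivOfLeConst ℝ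
    (volume : Measure (EuclideanSpace ℝ (Fin N))) Ω p.toNNReal t.toNNReal := ⟨_, rfl⟩
  refine ⟨C, C.2, fun v => ?_⟩
  suffices h : (toLp v, grad v) ∈ {w : Lp ℝ (ENNReal.ofReal p) (volume.restrict Ω) ×
      Lp (EuclideanSpace ℝ (Fin N)) (ENNReal.ofReal p) (volume.restrict Ω) |
      eLpNorm w.1 (ENNReal.ofReal t) (volume.restrict Ω) ≤ ENNReal.ofReal (C * ‖w.2‖)} from h
  refine induction_of_isClosed ?_ ?_ v
  · refine IsSeqClosed.isClosed fun w w' hw hlim => ?_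
    have h1 : Tendsto (fun n => (w n).1) atTop (𝓝 w'.1) :=
      (continuous_fst.tendsto _).comp hlim
    have h2 : Tendsto (fun n => ENNReal.ofReal (C * ‖(w n).2‖)) atTop
        (𝓝 (ENNReal.ofReal (C * ‖w'.2‖))) :=
      (ENNReal.continuous_ofReal.tendsto _).comp
        (((continuous_snd.tendsto _).comp hlim).norm.const_mul _)
    obtain ⟨σ, hσ, hae⟩ := (tendstoInMeasure_of_tendsto_Lp h1).exists_seq_tendsto_ae
    refine (Lp.eLpNorm_lim_le_liminf_eLpNorm
      (fun n => Lp.aestronglyMeasurable (w (σ n)).1) _ hae).trans ?_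
    rw [← (h2.comp hσ.tendsto_atTop).liminf_eq]
    exact liminf_le_liminf (Eventually.of_forall fun n => hw (σ n))
  · rintro w ⟨φ, hφ, h1, h2⟩
    have key := eLpNorm_le_eLpNorm_fderiv_of_le (volume : Measure (EuclideanSpace ℝ (Fin N)))
      (hφ.contDiff.of_le (by simp)) ((subset_tsupport φ).trans hφ.tsupport_subset)
      (p := p.toNNReal) (q := t.toNNReal) (by simpa using hp1.le) (by
        rw [finrank_euclideanSpace_fin, Real.toNNReal_lt_iff_lt_coe (by linarith)]
        simpa using hpN.out) (by
        rw [finrank_euclideanSpace_fin, Real.coe_toNNReal _ ht.le, NNReal.coe_inv,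
          Real.coe_toNNReal _ (by linarith)]
        simpa using htp) hb.out
    rw [← hCdef] at key
    have hnn : ENNReal.ofReal (C * ‖w.2‖) =
        C * eLpNorm w.2 (ENNReal.ofReal p) (volume.restrict Ω) := by
      rw [ENNReal.ofReal_mul C.coe_nonneg, Lp.norm_def, ENNReal.ofReal_toReal (Lp.eLpNorm_ne_top _)]
      simp
    calc eLpNorm w.1 (ENNReal.ofReal t) (volume.restrict Ω)
        = eLpNorm φ (ENNReal.ofReal t) (volume.restrict Ω) := eLpNorm_congr_ae h1
      _ ≤ eLpNorm φ (ENNReal.ofReal t) volume := eLpNorm_mono_measure _ Measure.restrict_le_self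
      _ ≤ C * eLpNorm (fderiv ℝ φ) (ENNReal.ofReal p) volume := key
      _ = ENNReal.ofReal (C * ‖w.2‖) := by
          rw [hnn, hφ.eLpNorm_fderiv_eq, eLpNorm_congr_ae h2]

end W0

/-! ### Compactness of the embedding into `L^p` -/

theorem rpow_lintegral_le_lintegral_rpow {α : Type*} [MeasurableSpace α] {ν : Measure α}
    [IsProbabilityMeasure ν] {p : ℝ} (hp : 1 < p) {f : α → ℝ≥0∞} (hf : AEMeasurable f ν) :
    (∫⁻ x, f x ∂ν) ^ p ≤ ∫⁻ x, f x ^ p ∂ν := by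
  have h := ENNReal.lintegral_mul_le_Lp_mul_Lq ν (Real.HolderConjugate.conjExponent hp) hf
    (aemeasurable_const (b := (1 : ℝ≥0∞)))
  simp only [Pi.mul_apply, mul_one, ENNReal.one_rpow, lintegral_one, measure_univ] at h
  calc (∫⁻ x, f x ∂ν) ^ p ≤ ((∫⁻ x, f x ^ p ∂ν) ^ (1 / p)) ^ p := by
        gcongr
    _ = ∫⁻ x, f x ^ p ∂ν := by
        rw [← ENNReal.rpow_mul, one_div_mul_cancel (by linarith), ENNReal.rpow_one]

/-- Fundamental theorem of calculus along the segment from x to x + z, then Jensen in t. -/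
theorem enorm_sub_translate_rpow_le {E : Type*} [NormedAddCommGroup E]
    [NormedSpace ℝ E] {φ : E → ℝ} (hφ : ContDiff ℝ 1 φ) {p : ℝ} (hp : 1 < p)
    (x z : E) :
    ‖φ x - φ (x + z)‖ₑ ^ p ≤
      ‖z‖ₑ ^ p * ∫⁻ t in Set.Icc (0 : ℝ) 1, ‖fderiv ℝ φ (x + t • z)‖ₑ ^ p := by
  have hd : ∀ t : ℝ, HasDerivAt (fun s : ℝ => φ (x + s • z)) (fderiv ℝ φ (x + t • z) z) t := by
    intro t
    have h1 : HasDerivAt (fun s : ℝ => x + s • z) z t := by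
      simpa using ((hasDerivAt_id t).smul_const z).const_add x
    exact ((hφ.differentiable one_ne_zero) _).hasFDerivAt.comp_hasDerivAt t h1
  have hc : Continuous fun t : ℝ => fderiv ℝ φ (x + t • z) :=
    (hφ.continuous_fderiv one_ne_zero).comp (by fun_prop)
  have hc' : Continuous fun t : ℝ => fderiv ℝ φ (x + t • z) z := hc.clm_apply continuous_const
  have hftc := intervalIntegral.integral_eq_sub_of_hasDerivAt (a := 0) (b := 1)
    (fun t _ => hd t) (hc'.intervalIntegrable 0 1)
  have : IsProbabilityMeasure (volume.restrict (Set.Icc (0 : ℝ) 1)) :=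
    ⟨by simp⟩
  have h1 : ‖φ x - φ (x + z)‖ₑ ≤
      ∫⁻ t in Set.Icc (0 : ℝ) 1, ‖fderiv ℝ φ (x + t • z)‖ₑ * ‖z‖ₑ := by
    have : φ x - φ (x + z) = - ∫ t in Set.Icc (0 : ℝ) 1, fderiv ℝ φ (x + t • z) z := by
      rw [integral_Icc_eq_integral_Ioc, ← intervalIntegral.integral_of_le zero_le_one, hftc]
      simp
    rw [this, enorm_neg]
    refine (enorm_integral_le_lintegral_enorm _).trans (lintegral_mono fun t => ?_)
    exact ContinuousLinearMap.le_opENorm _ _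
  rw [lintegral_mul_const _ hc.measurable.enorm] at h1
  calc ‖φ x - φ (x + z)‖ₑ ^ p
      ≤ ((∫⁻ t in Set.Icc (0 : ℝ) 1, ‖fderiv ℝ φ (x + t • z)‖ₑ) * ‖z‖ₑ) ^ p := by gcongr
    _ = ‖z‖ₑ ^ p * (∫⁻ t in Set.Icc (0 : ℝ) 1, ‖fderiv ℝ φ (x + t • z)‖ₑ) ^ p := by
        rw [ENNReal.mul_rpow_of_nonneg _ _ (by linarith), mul_comm]
    _ ≤ _ := by
        gcongr
        exact rpow_lintegral_le_lintegral_rpow hp hc.measurable.enorm.aemeasurable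

/-! ### Translation estimates and averages over balls -/

section Translation

variable {E : Type*} [NormedAddCommGroup E] [InnerProductSpace ℝ E] [FiniteDimensional ℝ E]
  [MeasurableSpace E] [BorelSpace E]

theorem lintegral_enorm_sub_translate_rpow_le {φ : E → ℝ} (hφ : ContDiff ℝ 1 φ) {p : ℝ}
    (hp : 1 < p) (z : E) :
    ∫⁻ x, ‖φ x - φ (x + z)‖ₑ ^ p ≤ ‖z‖ₑ ^ p * ∫⁻ x, ‖fderiv ℝ φ x‖ₑ ^ p := by
  have hm : Continuous (fderiv ℝ φ) := hφ.continuous_fderiv one_ne_zero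
  calc ∫⁻ x, ‖φ x - φ (x + z)‖ₑ ^ p
      ≤ ∫⁻ x, ‖z‖ₑ ^ p * ∫⁻ t in Set.Icc (0 : ℝ) 1, ‖fderiv ℝ φ (x + t • z)‖ₑ ^ p :=
        lintegral_mono fun x => enorm_sub_translate_rpow_le hφ hp x z
    _ = ‖z‖ₑ ^ p * ∫⁻ x, ∫⁻ t in Set.Icc (0 : ℝ) 1, ‖fderiv ℝ φ (x + t • z)‖ₑ ^ p :=
        lintegral_const_mul' _ _ (by simp [ENNReal.rpow_eq_top_iff]; intros; linarith)
    _ = ‖z‖ₑ ^ p * ∫⁻ t in Set.Icc (0 : ℝ) 1, ∫⁻ x, ‖fderiv ℝ φ (x + t • z)‖ₑ ^ p := by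
        rw [lintegral_lintegral_swap]
        have : Continuous fun q : E × ℝ => fderiv ℝ φ (q.1 + q.2 • z) :=
          hm.comp (by fun_prop)
        exact (this.measurable.enorm.pow_const p).aemeasurable
    _ = ‖z‖ₑ ^ p * ∫⁻ _t in Set.Icc (0 : ℝ) 1, ∫⁻ x, ‖fderiv ℝ φ x‖ₑ ^ p := by
        congr 1
        refine lintegral_congr fun t => ?_
        exact lintegral_add_right_eq_self (fun x => ‖fderiv ℝ φ x‖ₑ ^ p) (t • z)
    _ = _ := by simp

/-- Jensen for the average, followed by the inclusion of the ball about x in the ball of radius 2δ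
about y. The right side no longer depends on x, so x may later vary with y, as the nearest point of
a finite net does. -/
theorem enorm_sub_average_ball_rpow_le {φ : E → ℝ} (hφ : Continuous φ)
    {p : ℝ} (hp : 1 < p) {δ : ℝ} (hδ : 0 < δ) {x y : E} (hxy : dist y x < δ) :
    ‖φ y - ⨍ w in Metric.ball x δ, φ w‖ₑ ^ p ≤
      (volume (Metric.ball (0 : E) δ))⁻¹ *
        ∫⁻ z in Metric.ball (0 : E) (2 * δ), ‖φ y - φ (y + z)‖ₑ ^ p := by
  have hB0 : volume (Metric.ball x δ) ≠ 0 := (Metric.measure_ball_pos volume x hδ).ne'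
  have hBt : volume (Metric.ball x δ) ≠ ⊤ := measure_ball_lt_top.ne
  set ν : Measure E := (volume (Metric.ball x δ))⁻¹ • volume.restrict (Metric.ball x δ) with hν
  have : IsProbabilityMeasure ν := ⟨by
    simp [hν, ENNReal.inv_mul_cancel hB0 hBt]⟩
  have havg : ⨍ w in Metric.ball x δ, φ w = ∫ w, φ w ∂ν := by
    rw [average, Measure.restrict_apply_univ]
  have hint : Integrable φ ν := by
    refine Integrable.smul_measure ?_ (ENNReal.inv_ne_top.2 hB0)
    exact (hφ.continuousOn.integrableOn_compact (isCompact_closedBall x δ)).mono_set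
      Metric.ball_subset_closedBall
  have h1 : ‖φ y - ∫ w, φ w ∂ν‖ₑ ≤ ∫⁻ w, ‖φ y - φ w‖ₑ ∂ν := by
    have : φ y - ∫ w, φ w ∂ν = ∫ w, (φ y - φ w) ∂ν := by
      rw [integral_sub (integrable_const _) hint]
      simp
    rw [this]
    exact enorm_integral_le_lintegral_enorm _
  rw [havg]
  calc ‖φ y - ∫ w, φ w ∂ν‖ₑ ^ p ≤ (∫⁻ w, ‖φ y - φ w‖ₑ ∂ν) ^ p := by gcongr
    _ ≤ ∫⁻ w, ‖φ y - φ w‖ₑ ^ p ∂ν := rpow_lintegral_le_lintegral_rpow hp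
        ((continuous_const.sub hφ).measurable.enorm.aemeasurable)
    _ = (volume (Metric.ball x δ))⁻¹ * ∫⁻ w in Metric.ball x δ, ‖φ y - φ w‖ₑ ^ p := by
        rw [hν, lintegral_smul_measure, smul_eq_mul]
    _ ≤ _ := by
        rw [Measure.addHaar_ball_center]
        refine mul_le_mul_right ?_ _
        rw [← lintegral_indicator measurableSet_ball, ← lintegral_indicator measurableSet_ball,
          ← lintegral_add_left_eq_self _ y]
        refine lintegral_mono fun z => ?_
        by_cases hz : y + z ∈ Metric.ball x δ
        · have hz' : z ∈ Metric.ball (0 : E) (2 * δ) := by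
            rw [mem_ball_zero_iff]
            have h2 : ‖z‖ = dist (y + z) y := by simp
            rw [h2]
            calc dist (y + z) y ≤ dist (y + z) x + dist x y := dist_triangle _ _ _
              _ < 2 * δ := by
                rw [dist_comm x y]
                have := Metric.mem_ball.1 hz
                linarith
          rw [Set.indicator_of_mem hz, Set.indicator_of_mem hz']
        · rw [Set.indicator_of_notMem hz]
          exact zero_le

theorem lintegral_lintegral_ball_enorm_sub_rpow_le {φ : E → ℝ} (hφ : ContDiff ℝ 1 φ) {p : ℝ}
    (hp : 1 < p) {δ : ℝ} (hδ : 0 < δ) :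
    ∫⁻ y, (volume (Metric.ball (0 : E) δ))⁻¹ *
        ∫⁻ z in Metric.ball (0 : E) (2 * δ), ‖φ y - φ (y + z)‖ₑ ^ p ≤
      (ENNReal.ofReal (2 ^ Module.finrank ℝ E * (2 * δ))) ^ p *
        ∫⁻ x, ‖fderiv ℝ φ x‖ₑ ^ p := by
  have hB0 : volume (Metric.ball (0 : E) δ) ≠ 0 := (Metric.measure_ball_pos volume _ hδ).ne'
  have hBt : volume (Metric.ball (0 : E) δ) ≠ ⊤ := measure_ball_lt_top.ne
  have hvol : volume (Metric.ball (0 : E) (2 * δ)) =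
      ENNReal.ofReal (2 ^ Module.finrank ℝ E) * volume (Metric.ball (0 : E) δ) :=
    Measure.addHaar_ball_mul_of_pos _ _ two_pos _
  have h2 : (1 : ℝ) ≤ 2 ^ Module.finrank ℝ E := one_le_pow₀ one_le_two
  have hm : Continuous fun q : E × E => φ q.1 - φ (q.1 + q.2) :=
    (hφ.continuous.comp continuous_fst).sub (hφ.continuous.comp (by fun_prop))
  rw [lintegral_const_mul' _ _ (ENNReal.inv_ne_top.2 hB0),
    lintegral_lintegral_swap (by exact (hm.measurable.enorm.pow_const p).aemeasurable)]
  calc (volume (Metric.ball (0 : E) δ))⁻¹ *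
        ∫⁻ z in Metric.ball (0 : E) (2 * δ), ∫⁻ y, ‖φ y - φ (y + z)‖ₑ ^ p
      ≤ (volume (Metric.ball (0 : E) δ))⁻¹ *
        ∫⁻ _z in Metric.ball (0 : E) (2 * δ),
          ENNReal.ofReal (2 * δ) ^ p * ∫⁻ x, ‖fderiv ℝ φ x‖ₑ ^ p := by
        refine mul_le_mul_right ?_ _
        refine setLIntegral_mono' measurableSet_ball fun z hz => ?_
        refine (lintegral_enorm_sub_translate_rpow_le hφ hp z).trans ?_
        gcongr
        rw [← ofReal_norm]
        exact ENNReal.ofReal_le_ofReal (mem_ball_zero_iff.1 hz).le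
    _ = ENNReal.ofReal (2 ^ Module.finrank ℝ E) * ENNReal.ofReal (2 * δ) ^ p *
          ∫⁻ x, ‖fderiv ℝ φ x‖ₑ ^ p := by
        rw [setLIntegral_const, hvol]
        calc (volume (Metric.ball (0 : E) δ))⁻¹ * (ENNReal.ofReal (2 * δ) ^ p *
              (∫⁻ x, ‖fderiv ℝ φ x‖ₑ ^ p) * (ENNReal.ofReal (2 ^ Module.finrank ℝ E) *
                volume (Metric.ball (0 : E) δ)))
            = ((volume (Metric.ball (0 : E) δ))⁻¹ * volume (Metric.ball (0 : E) δ)) *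
              (ENNReal.ofReal (2 ^ Module.finrank ℝ E) * ENNReal.ofReal (2 * δ) ^ p *
                ∫⁻ x, ‖fderiv ℝ φ x‖ₑ ^ p) := by ring
          _ = _ := by rw [ENNReal.inv_mul_cancel hB0 hBt, one_mul]
    _ ≤ _ := by
        gcongr
        rw [ENNReal.ofReal_mul (zero_le_one.trans h2), ENNReal.mul_rpow_of_nonneg _ _ (by linarith)]
        gcongr
        -- The volume ratio 2^N of the two balls appears to the first power; as 2^N ≥ 1 and p ≥ 1 it
        -- is at most its own p-th power.
        exact ENNReal.le_rpow_self_of_one_le (by rwa [ENNReal.one_le_ofReal]) hp.le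

end Translation

namespace W0

variable {N : ℕ} {Ω : Set (EuclideanSpace ℝ (Fin N))} {p : ℝ} [Fact (1 < p)]

/-- A finite rank approximation of the identity by local averages. -/
theorem exists_isCompactOperator_approx (hb : Bornology.IsBounded Ω) {δ : ℝ} (hδ : 0 < δ) :
    ∃ P : Lp ℝ (ENNReal.ofReal p) (volume.restrict Ω) →L[ℝ]
        Lp ℝ (ENNReal.ofReal p) (volume.restrict Ω),
      IsCompactOperator P ∧ ∀ v : W0 Ω p,
        ‖toLp v - P (toLp v)‖ ≤ 2 ^ N * (2 * δ) * ‖grad v‖ := by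
  have hp1 : 1 < p := Fact.out
  have := isFiniteMeasure_restrict hb
  set m : Measure (EuclideanSpace ℝ (Fin N)) := volume.restrict Ω with hm
  set e := TopologicalSpace.denseSeq (EuclideanSpace ℝ (Fin N)) with he
  -- A finite δ-net of Ω taken from a dense sequence; π below sends a point to its nearest net
  -- point.
  obtain ⟨n, hn⟩ : ∃ n, ∀ x ∈ Ω, ∃ k ≤ n, dist (e k) x < δ := by
    obtain ⟨s, hs⟩ := hb.isCompact_closure.elim_finite_subcover
      (fun k : ℕ => Metric.ball (e k) δ) (fun _ => Metric.isOpen_ball) (fun x _ => by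
        obtain ⟨k, hk⟩ := (TopologicalSpace.denseRange_denseSeq _).exists_dist_lt x hδ
        exact Set.mem_iUnion.2 ⟨k, hk⟩)
    obtain ⟨n, hn⟩ := s.exists_le
    refine ⟨n, fun x hx => ?_⟩
    obtain ⟨k, hks, hk⟩ := Set.mem_iUnion₂.1 (hs (subset_closure hx))
    exact ⟨k, hn k hks, by rwa [dist_comm]⟩
  set π := SimpleFunc.nearestPt e n with hπ
  have hπd : ∀ x ∈ Ω, dist x (π x) < δ := by
    intro x hx
    obtain ⟨k, hk, hkd⟩ := hn x hx
    have h1 := SimpleFunc.edist_nearestPt_le e x hk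
    rw [edist_dist, edist_dist, ENNReal.ofReal_le_ofReal_iff dist_nonneg] at h1
    rw [dist_comm]
    exact h1.trans_lt hkd
  let q := ENNReal.conjExponent (ENNReal.ofReal p)
  have : Fact (1 ≤ q) := ⟨by simp [q, ENNReal.conjExponent]⟩
  -- The average over the ball about c, written as a duality pairing with an indicator to be
  -- continuous on L^p. The integral runs over Ω only, which is harmless because test functions
  -- vanish outside Ω. P then replaces w by the step function x ↦ ℓ (π x) w.
  let ℓ : EuclideanSpace ℝ (Fin N) → Lp ℝ (ENNReal.ofReal p) m →L[ℝ] ℝ := fun c =>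
    (volume.real (Metric.ball c δ))⁻¹ •
      ((ContinuousLinearMap.mul ℝ ℝ).lpPairing m (ENNReal.ofReal p) q).flip
        (indicatorConstLp q (measurableSet_ball (x := c) (ε := δ)) (measure_ne_top m _) 1)
  let b : EuclideanSpace ℝ (Fin N) → Lp ℝ (ENNReal.ofReal p) m := fun c =>
    indicatorConstLp (ENNReal.ofReal p) (π.measurableSet_fiber c) (measure_ne_top m _) 1
  let P : Lp ℝ (ENNReal.ofReal p) m →L[ℝ] Lp ℝ (ENNReal.ofReal p) m :=
    ∑ c ∈ π.range, (ℓ c).smulRight (b c)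
  have hℓ : ∀ (c : EuclideanSpace ℝ (Fin N)) (φ : EuclideanSpace ℝ (Fin N) → ℝ)
      (w : Lp ℝ (ENNReal.ofReal p) m), IsTestFunction Ω φ → w =ᵐ[m] φ →
      ℓ c w = ⨍ x in Metric.ball c δ, φ x := by
    intro c φ w hφ hw
    have h1 : ℓ c w = (volume.real (Metric.ball c δ))⁻¹ *
        ∫ x, w x * (indicatorConstLp q (measurableSet_ball (x := c) (ε := δ))
          (measure_ne_top m _) (1 : ℝ) : EuclideanSpace ℝ (Fin N) → ℝ) x ∂m := by
      simp only [ℓ, smul_apply, ContinuousLinearMap.flip_apply,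
        ContinuousLinearMap.lpPairing_eq_integral, ContinuousLinearMap.mul_apply', smul_eq_mul]
    rw [h1, setAverage_eq, smul_eq_mul]
    congr 1
    calc _ = ∫ x, (Metric.ball c δ).indicator φ x ∂m := by
          refine integral_congr_ae ?_
          filter_upwards [hw, indicatorConstLp_coeFn (μ := m) (p := q)
            (hs := measurableSet_ball (x := c) (ε := δ)) (hμs := measure_ne_top m _)
            (c := (1 : ℝ))] with x hx hx2
          rw [hx, hx2]
          by_cases hxb : x ∈ Metric.ball c δ
          · rw [Set.indicator_of_mem hxb, Set.indicator_of_mem hxb, mul_one]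
          · rw [Set.indicator_of_notMem hxb, Set.indicator_of_notMem hxb, mul_zero]
      _ = ∫ x, (Metric.ball c δ).indicator φ x := by
          refine setIntegral_eq_integral_of_forall_compl_eq_zero fun x hx => ?_
          have : φ x = 0 := image_eq_zero_of_notMem_tsupport fun h => hx (hφ.tsupport_subset h)
          by_cases hxb : x ∈ Metric.ball c δ
          · rw [Set.indicator_of_mem hxb, this]
          · rw [Set.indicator_of_notMem hxb]
      _ = _ := integral_indicator measurableSet_ball
  have hP : ∀ w : Lp ℝ (ENNReal.ofReal p) m, P w =ᵐ[m] fun x => ℓ (π x) w := by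
    intro w
    have hPw : P w = ∑ c ∈ π.range, ℓ c w • b c := by
      simp [P, sum_apply]
    have hb' : ∀ᵐ x ∂m, ∀ c ∈ π.range, (ℓ c w • b c : Lp ℝ (ENNReal.ofReal p) m) x =
        if π x = c then ℓ c w else 0 := by
      rw [Filter.eventually_all_finset]
      intro c _
      filter_upwards [Lp.coeFn_smul (ℓ c w) (b c), indicatorConstLp_coeFn (μ := m)
        (p := ENNReal.ofReal p) (hs := π.measurableSet_fiber c) (hμs := measure_ne_top m _)
        (c := (1 : ℝ))] with x h1 h2
      rw [h1, Pi.smul_apply, h2]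
      by_cases hx : π x = c
      · rw [Set.indicator_of_mem (by exact hx), if_pos hx, smul_eq_mul, mul_one]
      · rw [Set.indicator_of_notMem (by exact hx), if_neg hx, smul_zero]
    rw [hPw]
    filter_upwards [Lp.coeFn_finsetSum π.range (fun c => ℓ c w • b c), hb'] with x hx hx2
    rw [hx, Finset.sum_apply, Finset.sum_congr rfl hx2, Finset.sum_ite_eq,
      if_pos (SimpleFunc.mem_range_self π x)]
  refine ⟨P, ?_, fun v => ?_⟩
  · have : ∀ s : Finset (EuclideanSpace ℝ (Fin N)),
        IsCompactOperator (∑ c ∈ s, (ℓ c).smulRight (b c) :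
          Lp ℝ (ENNReal.ofReal p) m →L[ℝ] Lp ℝ (ENNReal.ofReal p) m) := by
      intro s
      classical
      induction s using Finset.induction_on with
      | empty => simpa using isCompactOperator_zero
      | insert c s hc ih =>
        rw [Finset.sum_insert hc]
        refine IsCompactOperator.add ?_ ih
        have h1 : IsCompactOperator (ContinuousLinearMap.toSpanSingleton ℝ (b c)) :=
          isCompactOperator_of_locallyCompactSpace_rng _
        exact h1.comp_clm (ℓ c)
    exact this _
  · suffices h : (toLp v, grad v) ∈ {w : Lp ℝ (ENNReal.ofReal p) (volume.restrict Ω) ×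
        Lp (EuclideanSpace ℝ (Fin N)) (ENNReal.ofReal p) (volume.restrict Ω) |
        ‖w.1 - P w.1‖ ≤ 2 ^ N * (2 * δ) * ‖w.2‖} from h
    refine induction_of_isClosed ?_ ?_ v
    · exact isClosed_le (by fun_prop) (by fun_prop)
    · rintro w ⟨φ, hφ, h1, h2⟩
      have hpp : ENNReal.ofReal p ≠ 0 := by simpa using by linarith
      have hC : (0 : ℝ) ≤ 2 ^ N * (2 * δ) := by positivity
      have hφ1 : ContDiff ℝ 1 φ := hφ.contDiff.of_le (by simp)
      have e1 : eLpNorm (w.1 - P w.1 : Lp ℝ (ENNReal.ofReal p) m) (ENNReal.ofReal p) m ≤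
          ENNReal.ofReal (2 ^ N * (2 * δ)) *
            eLpNorm w.2 (ENNReal.ofReal p) m := by
        have hptr : (ENNReal.ofReal p).toReal = p := ENNReal.toReal_ofReal (by linarith)
        rw [eLpNorm_congr_ae h2, ← hφ.eLpNorm_fderiv_eq,
          eLpNorm_eq_lintegral_rpow_enorm_toReal hpp ENNReal.ofReal_ne_top,
          eLpNorm_eq_lintegral_rpow_enorm_toReal hpp ENNReal.ofReal_ne_top, hptr]
        calc _ ≤ (ENNReal.ofReal (2 ^ N * (2 * δ)) ^ p * ∫⁻ x, ‖fderiv ℝ φ x‖ₑ ^ p) ^ (1 / p) := by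
              gcongr
              have key := lintegral_lintegral_ball_enorm_sub_rpow_le hφ1 hp1 hδ
              rw [finrank_euclideanSpace_fin] at key
              refine le_trans ?_ key
              refine le_trans ?_ (setLIntegral_le_lintegral Ω _)
              refine lintegral_mono_ae ?_
              -- The set where the distance is below δ is measurable, so the bound on Ω passes to
              -- the restricted measure without measurability of Ω.
              have hΩae : ∀ᵐ x ∂m, dist x (π x) < δ :=
                (ae_restrict_iff (measurableSet_lt (measurable_id.dist π.measurable)
                  measurable_const)).2 (Eventually.of_forall hπd)
              filter_upwards [Lp.coeFn_sub w.1 (P w.1), h1, hP w.1, hΩae] with x e1 e2 e3 e4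
              rw [e1, Pi.sub_apply, e2, e3, hℓ _ φ w.1 hφ h1]
              exact enorm_sub_average_ball_rpow_le hφ1.continuous hp1 hδ e4
          _ = _ := by
              rw [ENNReal.mul_rpow_of_nonneg _ _ (by positivity), ← ENNReal.rpow_mul,
                mul_one_div_cancel (by linarith), ENNReal.rpow_one]
      have e2 := ENNReal.toReal_mono
        (ENNReal.mul_ne_top ENNReal.ofReal_ne_top (Lp.eLpNorm_ne_top w.2)) e1
      rwa [ENNReal.toReal_mul, ENNReal.toReal_ofReal hC] at e2

variable [hpN : Fact (p < N)] [hb : Fact (Bornology.IsBounded Ω)]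

/-- The Rellich–Kondrachov theorem. -/
theorem isCompactOperator_toLpL : IsCompactOperator (toLpL : W0 Ω p →L[ℝ] _) := by
  -- With δ = 1/(n+1), the inclusion becomes an operator norm limit of compact operators.
  choose P hPc hP using fun n : ℕ =>
    exists_isCompactOperator_approx (p := p) hb.out (one_div_pos.2 (Nat.cast_add_one_pos (α := ℝ) n))
  refine isCompactOperator_of_tendsto (l := atTop) (F := fun n => (P n).comp toLpL) ?_
    (Eventually.of_forall fun n => (hPc n).comp_clm toLpL)
  rw [tendsto_iff_norm_sub_tendsto_zero]
  have hlim : Tendsto (fun n : ℕ => (2 : ℝ) ^ N * (2 * (1 / ((n : ℝ) + 1)))) atTop (𝓝 0) := by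
    simpa using (tendsto_one_div_add_atTop_nhds_zero_nat (𝕜 := ℝ)).const_mul 2 |>.const_mul (2 ^ N)
  refine squeeze_zero (fun _ => norm_nonneg _) (fun n => ?_) hlim
  refine ContinuousLinearMap.opNorm_le_bound _ (by positivity) fun v => ?_
  rw [sub_apply, ContinuousLinearMap.comp_apply, toLpL_apply, norm_sub_rev]
  exact hP n v

theorem exists_subseq_cauchySeq_toLp {u : ℕ → W0 Ω p} {M : ℝ} (hu : ∀ n, ‖u n‖ ≤ M) :
    ∃ σ : ℕ → ℕ, StrictMono σ ∧ CauchySeq fun n => toLp (u (σ n)) := by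
  obtain ⟨K, hK, hsub⟩ :=
    (isCompactOperator_toLpL (Ω := Ω) (p := p)).image_closedBall_subset_compact M
  obtain ⟨a, -, σ, hσ, hlim⟩ := hK.tendsto_subseq (x := fun n => toLp (u n)) fun n =>
    hsub ⟨u n, by simpa using hu n, rfl⟩
  exact ⟨σ, hσ, hlim.cauchySeq⟩

end W0

/-! ### The nonlinearities -/

theorem Real.add_rpow_le_two_rpow_mul {x y m : ℝ} (hx : 0 ≤ x) (hy : 0 ≤ y) (hm : 0 ≤ m) :
    (x + y) ^ m ≤ 2 ^ m * (x ^ m + y ^ m) := by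
  have h1 : (max x y) ^ m ≤ x ^ m + y ^ m := by
    rcases max_cases x y with ⟨h, -⟩ | ⟨h, -⟩ <;> rw [h]
    · linarith [Real.rpow_nonneg hy m]
    · linarith [Real.rpow_nonneg hx m]
  calc (x + y) ^ m ≤ (2 * max x y) ^ m := by
        refine Real.rpow_le_rpow (by positivity) ?_ hm
        linarith [le_max_left x y, le_max_right x y]
    _ = 2 ^ m * (max x y) ^ m := Real.mul_rpow (by norm_num) (le_max_of_le_left hx)
    _ ≤ _ := by gcongr

theorem Real.rpow_le_one_add_rpow {x a b : ℝ} (hx : 0 ≤ x) (ha : 0 ≤ a) (hab : a ≤ b) :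
    x ^ a ≤ 1 + x ^ b := by
  rcases le_total x 1 with h | h
  · linarith [Real.rpow_le_one hx h ha, Real.rpow_nonneg hx b]
  · linarith [Real.rpow_le_rpow_of_exponent_le h hab]

/-- Interpolation between powers with a free parameter. -/
theorem Real.rpow_le_mul_rpow_add {x L a b d : ℝ} (hx : 0 ≤ x) (hL : 0 < L) (ha : 0 < a)
    (hab : a ≤ b) (hbd : b ≤ d) :
    x ^ b ≤ L ^ (b - a) * x ^ a + L ^ (b - d) * x ^ d := by
  rcases hx.eq_or_lt with rfl | hx0
  · rw [Real.zero_rpow (by linarith), Real.zero_rpow (by linarith), Real.zero_rpow (by linarith)]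
    simp
  · have h1 : 0 ≤ L ^ (b - a) * x ^ a := by positivity
    have h2 : 0 ≤ L ^ (b - d) * x ^ d := by positivity
    -- Below the threshold L the power a dominates x^b, above it the power d does.
    rcases le_total x L with h | h
    · have : x ^ b = x ^ (b - a) * x ^ a := by rw [← Real.rpow_add hx0]; ring_nf
      have h3 : x ^ (b - a) ≤ L ^ (b - a) := Real.rpow_le_rpow hx h (by linarith)
      have h4 : x ^ (b - a) * x ^ a ≤ L ^ (b - a) * x ^ a := by gcongr
      linarith
    · have : x ^ b = x ^ (b - d) * x ^ d := by rw [← Real.rpow_add hx0]; ring_nf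
      have h3 : x ^ (b - d) ≤ L ^ (b - d) :=
        Real.rpow_le_rpow_of_nonpos hL h (by linarith)
      have h4 : x ^ (b - d) * x ^ d ≤ L ^ (b - d) * x ^ d := by gcongr
      linarith

/-- The function vanishes to the left of a, compactness handles [a, 0], and on the positive axis (1
+ μs)^m is comparable to 1 + s^m. -/
theorem exists_growth_bound {g : ℝ → ℝ} (hg : Continuous g) {a m C μ : ℝ} (hm : 0 ≤ m)
    (hμ : 0 ≤ μ) (hC : 0 ≤ C) (ha : ∀ s ≤ a, g s = 0)
    (h : ∀ s, 0 ≤ s → |g s| ≤ C * (1 + μ * s) ^ m) :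
    ∃ A, 0 ≤ A ∧ ∀ s, |g s| ≤ A * (1 + |s| ^ m) := by
  obtain ⟨B, hB⟩ := (isCompact_Icc (a := a) (b := 0)).exists_bound_of_continuousOn hg.continuousOn
  refine ⟨|B| + C * (2 ^ m * (1 + μ ^ m)), by positivity, fun s => ?_⟩
  have hs : 0 ≤ |s| ^ m := by positivity
  have hK : 0 ≤ C * (2 ^ m * (1 + μ ^ m)) := by positivity
  rcases le_total 0 s with h0 | h0
  · have h1 : (1 + μ * s) ^ m ≤ 2 ^ m * ((1 + μ ^ m) * (1 + |s| ^ m)) := by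
      refine (Real.add_rpow_le_two_rpow_mul zero_le_one (mul_nonneg hμ h0) hm).trans ?_
      rw [Real.one_rpow, Real.mul_rpow hμ h0, abs_of_nonneg h0]
      rw [abs_of_nonneg h0] at hs
      have : 0 ≤ μ ^ m := by positivity
      gcongr
      nlinarith
    calc |g s| ≤ C * (2 ^ m * ((1 + μ ^ m) * (1 + |s| ^ m))) := (h s h0).trans (by gcongr)
      _ = C * (2 ^ m * (1 + μ ^ m)) * (1 + |s| ^ m) := by ring
      _ ≤ _ := by
        gcongr
        linarith [abs_nonneg B]
  · have h1 : |g s| ≤ |B| := by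
      rcases le_total s a with h2 | h2
      · rw [ha s h2, abs_zero]
        positivity
      · exact (hB s ⟨h2, h0⟩).trans (le_abs_self B)
    nlinarith [abs_nonneg B]

theorem abs_primitive_le {g : ℝ → ℝ} {A m : ℝ} (hm : 0 ≤ m) (hA : 0 ≤ A)
    (h : ∀ s, |g s| ≤ A * (1 + |s| ^ m)) (s : ℝ) :
    |∫ t in (0 : ℝ)..s, g t| ≤ 2 * A * (1 + |s| ^ (m + 1)) := by
  have h1 : ‖∫ t in (0 : ℝ)..s, g t‖ ≤ A * (1 + |s| ^ m) * |s - 0| := by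
    refine intervalIntegral.norm_integral_le_of_norm_le_const fun t ht => (h t).trans ?_
    have : |t| ≤ |s| := by
      rcases Set.mem_uIoc.1 ht with ⟨h1, h2⟩ | ⟨h1, h2⟩
      · rw [abs_of_pos h1, abs_of_pos (h1.trans_le h2)]
        exact h2
      · rw [abs_of_nonpos h2, abs_of_neg (h1.trans_le h2)]
        linarith
    gcongr
  rw [sub_zero] at h1
  have h2 : |s| ^ (m + 1) = |s| ^ m * |s| := by
    rw [Real.rpow_add_of_nonneg (abs_nonneg s) hm zero_le_one, Real.rpow_one]
  have h3 := Real.rpow_le_one_add_rpow (abs_nonneg s) zero_le_one (by linarith : 1 ≤ m + 1)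
  rw [Real.rpow_one] at h3
  have h4 : 0 ≤ |s| ^ (m + 1) := by positivity
  refine h1.trans ?_
  calc A * (1 + |s| ^ m) * |s| = A * (|s| + |s| ^ (m + 1)) := by rw [h2]; ring
    _ ≤ A * (2 * (1 + |s| ^ (m + 1))) := by
      gcongr
      linarith
    _ = _ := by ring

theorem primitive_eq_of_le {g : ℝ → ℝ} (hg : Continuous g) {a : ℝ} (ha : ∀ s ≤ a, g s = 0) {s : ℝ}
    (hs : s ≤ a) : ∫ t in (0 : ℝ)..s, g t = ∫ t in (0 : ℝ)..a, g t := by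
  rw [← intervalIntegral.integral_add_adjacent_intervals (hg.intervalIntegrable 0 a)
    (hg.intervalIntegrable a s)]
  have : ∫ t in a..s, g t = ∫ t in a..s, (0 : ℝ) := by
    refine intervalIntegral.integral_congr fun t ht => ha t ?_
    rw [Set.uIcc_of_ge hs] at ht
    exact ht.2
  rw [this]
  simp

section Nonlinearities

variable {p q μ : ℝ}

theorem one_add_mul_pos_iff (hμ : 0 < μ) {s : ℝ} : 0 < 1 + μ * s ↔ -1 / μ < s := by
  rw [div_lt_iff₀ hμ]
  constructor <;> intro h <;> linarith

theorem gFun_of_le {s : ℝ} (hs : s ≤ -1 / μ) : gFun p q μ s = 0 := if_neg hs.not_gt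

theorem fFun_of_le {s : ℝ} (hs : s ≤ -1 / μ) : fFun p μ s = 0 := if_neg hs.not_gt

theorem gFun_of_pos (hμ : 0 < μ) {s : ℝ} (hs : 0 < s) :
    gFun p q μ s =
      (p - 1) ^ (q - p + 1) / μ ^ q * ((1 + μ * s) ^ (p - 1) * Real.log (1 + μ * s) ^ q) := by
  have h1 : 1 < 1 + μ * s := by nlinarith
  have hl : 0 < Real.log (1 + μ * s) := Real.log_pos h1
  rw [gFun, if_pos ((one_add_mul_pos_iff hμ).1 (by linarith)), abs_of_pos hl,
    Real.rpow_sub_one hl.ne']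
  field_simp

theorem continuous_abs_rpow_sub_one_mul (hq : 0 < q) : Continuous fun x : ℝ => |x| ^ (q - 1) * x := by
  rw [continuous_iff_continuousAt]
  intro x
  by_cases hx : x = 0
  · subst hx
    rw [ContinuousAt, mul_zero]
    refine squeeze_zero_norm (a := fun x : ℝ => |x| ^ q) (fun x => ?_) ?_
    · rw [norm_mul, Real.norm_of_nonneg (by positivity), Real.norm_eq_abs]
      by_cases h : x = 0
      · simp [h, Real.zero_rpow hq.ne']
      · rw [Real.rpow_sub_one (abs_ne_zero.2 h), div_mul_cancel₀ _ (abs_ne_zero.2 h)]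
    · have : Continuous fun x : ℝ => |x| ^ q := continuous_abs.rpow_const fun _ => Or.inr hq.le
      simpa [Real.zero_rpow hq.ne'] using this.tendsto 0
  · exact ((continuous_abs.continuousAt).rpow_const (Or.inl (abs_ne_zero.2 hx))).mul continuousAt_id

theorem continuousOn_rpow_mul_log (hp : 1 < p) (hq : 0 < q) :
    ContinuousOn (fun t : ℝ => t ^ (p - 1) * (|Real.log t| ^ (q - 1) * Real.log t))
      (Set.Ici 0) := by
  intro t ht
  rcases (Set.mem_Ici.1 ht).eq_or_lt with rfl | ht0
  · have hr : 0 < (p - 1) / q := div_pos (by linarith) hq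
    -- Near 0, t^(p-1) |ln t|^q is the q-th power of |ln t| t^((p-1)/q), which tends to 0. The value
    -- at t = 0 is also 0, thanks to `Real.log 0 = 0`.
    have h1 : ContinuousWithinAt (fun t : ℝ => |Real.log t * t ^ ((p - 1) / q)| ^ q)
        (Set.Ioi 0) 0 := by
      have h2 := (tendsto_log_mul_rpow_nhdsGT_zero hr).abs.rpow_const (p := q) (Or.inr hq.le)
      simpa [ContinuousWithinAt, Real.zero_rpow hq.ne', Real.zero_rpow hr.ne'] using h2
    rw [← Set.Ioi_insert, continuousWithinAt_insert_self]
    rw [ContinuousWithinAt] at h1 ⊢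
    simp only [Real.log_zero, zero_mul, abs_zero, Real.zero_rpow hq.ne'] at h1
    simp only [Real.log_zero, mul_zero]
    refine squeeze_zero_norm' ?_ h1
    filter_upwards [self_mem_nhdsWithin] with t ht
    have ht' : 0 < t := ht
    rw [abs_mul, Real.mul_rpow (abs_nonneg _) (abs_nonneg _), abs_of_pos (Real.rpow_pos_of_pos ht' _),
      ← Real.rpow_mul ht'.le, div_mul_cancel₀ _ hq.ne', norm_mul, norm_mul,
      Real.norm_of_nonneg (by positivity), Real.norm_of_nonneg (by positivity), Real.norm_eq_abs,
      mul_comm]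
    refine mul_le_mul_of_nonneg_right ?_ (by positivity)
    by_cases h : Real.log t = 0
    · simp [h, Real.zero_rpow hq.ne']
    · rw [Real.rpow_sub_one (abs_ne_zero.2 h), div_mul_cancel₀ _ (abs_ne_zero.2 h)]
  · have h1 : ContinuousAt (fun t : ℝ => |Real.log t| ^ (q - 1) * Real.log t) t :=
      (continuous_abs_rpow_sub_one_mul hq).continuousAt.comp (Real.continuousAt_log ht0.ne')
    exact ((Real.continuousAt_rpow_const t (p - 1) (Or.inl ht0.ne')).mul h1).continuousWithinAt

theorem continuous_gFun (hp : 1 < p) (hq : 0 < q) (hμ : 0 < μ) : Continuous (gFun p q μ) := by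
  have h : gFun p q μ = fun s => (p - 1) ^ (q - p + 1) / μ ^ q *
      ((fun t : ℝ => t ^ (p - 1) * (|Real.log t| ^ (q - 1) * Real.log t)) (max 0 (1 + μ * s))) := by
    funext s
    by_cases hs : -1 / μ < s
    · rw [gFun, if_pos hs, max_eq_right ((one_add_mul_pos_iff hμ).2 hs).le]
      ring
    · rw [gFun, if_neg hs, max_eq_left (not_lt.1 fun h => hs ((one_add_mul_pos_iff hμ).1 h))]
      simp
  rw [h]
  exact continuous_const.mul ((continuousOn_rpow_mul_log hp hq).comp_continuous
    (by fun_prop) fun s => Set.mem_Ici.2 (le_max_left _ _))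

theorem fFun_eq (hp : 1 < p) (hμ : 0 < μ) (s : ℝ) :
    fFun p μ s = (max 0 (1 + μ * s)) ^ (p - 1) / (p - 1) ^ (p - 1) := by
  by_cases hs : -1 / μ < s
  · rw [fFun, if_pos hs, max_eq_right ((one_add_mul_pos_iff hμ).2 hs).le]
  · rw [fFun, if_neg hs, max_eq_left (not_lt.1 fun h => hs ((one_add_mul_pos_iff hμ).1 h)),
      Real.zero_rpow (by linarith), zero_div]

theorem continuous_fFun (hp : 1 < p) (hμ : 0 < μ) : Continuous (fFun p μ) := by
  rw [funext (fFun_eq hp hμ)]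
  refine Continuous.div_const (Continuous.rpow_const (by fun_prop) fun s => Or.inr ?_) _
  linarith

theorem exists_abs_fFun_le (hp : 1 < p) (hμ : 0 < μ) :
    ∃ A, 0 ≤ A ∧ ∀ s, |fFun p μ s| ≤ A * (1 + |s| ^ (p - 1)) := by
  have hc : 0 ≤ ((p - 1) ^ (p - 1))⁻¹ := inv_nonneg.2 (Real.rpow_nonneg (by linarith) _)
  refine exists_growth_bound (continuous_fFun hp hμ) (by linarith) hμ.le hc
    (fun s hs => fFun_of_le hs) fun s hs => ?_
  have h1 : 0 ≤ 1 + μ * s := by positivity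
  rw [fFun_eq hp hμ, max_eq_right h1, abs_of_nonneg (div_nonneg (by positivity) (inv_nonneg.1 hc)),
    div_eq_inv_mul]

/-- The factor ln^q is absorbed by an arbitrarily small power, from ln t ≤ t^(η/q) / (η/q). -/
theorem exists_abs_gFun_le (hp : 1 < p) (hq : 0 < q) (hμ : 0 < μ) {η : ℝ} (hη : 0 < η) :
    ∃ A, 0 ≤ A ∧ ∀ s, |gFun p q μ s| ≤ A * (1 + |s| ^ (p - 1 + η)) := by
  have hA : 0 ≤ (p - 1) ^ (q - p + 1) / μ ^ q :=
    div_nonneg (Real.rpow_nonneg (by linarith) _) (by positivity)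
  refine exists_growth_bound (C := (p - 1) ^ (q - p + 1) / μ ^ q * (q / η) ^ q)
    (continuous_gFun hp hq hμ) (by linarith) hμ.le
    (by positivity) (fun s hs => gFun_of_le hs) fun s hs => ?_
  rcases hs.eq_or_lt with rfl | hs
  · have h0 : gFun p q μ 0 = 0 := by
      rw [gFun]
      simp
    rw [h0, abs_zero]
    simp only [mul_zero, add_zero, Real.one_rpow, mul_one]
    positivity
  · have h1 : 1 < 1 + μ * s := by nlinarith
    have hl : 0 < Real.log (1 + μ * s) := Real.log_pos h1
    have h2 : Real.log (1 + μ * s) ^ q ≤ (q / η) ^ q * (1 + μ * s) ^ η := by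
      have h3 := Real.log_le_rpow_div (by linarith : 0 ≤ 1 + μ * s) (div_pos hη hq)
      calc Real.log (1 + μ * s) ^ q ≤ ((1 + μ * s) ^ (η / q) / (η / q)) ^ q := by gcongr
        _ = (q / η * (1 + μ * s) ^ (η / q)) ^ q := by
          congr 1
          field_simp
        _ = (q / η) ^ q * (1 + μ * s) ^ η := by
          rw [Real.mul_rpow (by positivity) (by positivity), ← Real.rpow_mul (by linarith),
            div_mul_cancel₀ _ hq.ne']
    rw [gFun_of_pos hμ hs, abs_of_nonneg (by positivity),
      Real.rpow_add (by linarith : 0 < 1 + μ * s)]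
    calc _ ≤ (p - 1) ^ (q - p + 1) / μ ^ q *
          ((1 + μ * s) ^ (p - 1) * ((q / η) ^ q * (1 + μ * s) ^ η)) := by gcongr
      _ = _ := by ring

theorem FFun_eq_of_le (hp : 1 < p) (hμ : 0 < μ) {s : ℝ} (hs : -1 / μ < s) :
    FFun p μ s = ((1 + μ * s) ^ p - 1) / (p * μ * (p - 1) ^ (p - 1)) := by
  have hc : 0 < (p - 1) ^ (p - 1) := Real.rpow_pos_of_pos (by linarith) _
  have hp0 : 0 < p := by linarith
  have hd : ∀ t ∈ Set.uIcc 0 s, HasDerivAt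
      (fun t => (1 + μ * t) ^ p / (p * μ * (p - 1) ^ (p - 1))) (fFun p μ t) t := by
    intro t ht
    have ht' : -1 / μ < t := by
      have h1 : min 0 s ≤ t := ht.1
      have h2 : -1 / μ < 0 := div_neg_of_neg_of_pos (by norm_num) hμ
      exact (lt_min h2 hs).trans_le h1
    have hpos := (one_add_mul_pos_iff hμ).2 ht'
    have h1 : HasDerivAt (fun t => 1 + μ * t) μ t := by
      simpa using ((hasDerivAt_id t).const_mul μ).const_add 1
    refine ((h1.rpow_const (p := p) (Or.inl hpos.ne')).div_const
      (p * μ * (p - 1) ^ (p - 1))).congr_deriv ?_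
    rw [fFun, if_pos ht']
    field_simp
  rw [FFun, intervalIntegral.integral_eq_sub_of_hasDerivAt hd
    ((continuous_fFun hp hμ).intervalIntegrable _ _)]
  simp only [mul_zero, add_zero, Real.one_rpow]
  ring

/-- With t = 1 + μs, both f(s)s/p and F(s) have leading term t^p / (pμ(p-1)^(p-1)). These cancel,
and what remains has growth p-1 only; for s ≤ -1/μ the difference is constant. -/
theorem exists_abs_fFun_mul_sub_le (hp : 1 < p) (hμ : 0 < μ) :
    ∃ A, 0 ≤ A ∧ ∀ s, |fFun p μ s * s / p - FFun p μ s| ≤ A * (1 + |s| ^ (p - 1)) := by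
  have hc : 0 < (p - 1) ^ (p - 1) := Real.rpow_pos_of_pos (by linarith) _
  have hp0 : 0 < p := by linarith
  have hcf := continuous_fFun hp hμ
  obtain ⟨A, hA0, hA⟩ := exists_abs_fFun_le hp hμ
  have key : ∀ s, -1 / μ < s → fFun p μ s * s / p - FFun p μ s =
      1 / (p * μ * (p - 1) ^ (p - 1)) - fFun p μ s / (p * μ) := by
    intro s hs
    have hpos := (one_add_mul_pos_iff hμ).2 hs
    rw [FFun_eq_of_le hp hμ hs, fFun, if_pos hs]
    have : (1 + μ * s) ^ p = (1 + μ * s) ^ (p - 1) * (1 + μ * s) := by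
      rw [Real.rpow_sub_one hpos.ne']
      field_simp
    rw [this]
    field_simp
    ring
  refine ⟨|FFun p μ (-1 / μ)| + 1 / (p * μ * (p - 1) ^ (p - 1)) + A / (p * μ), by positivity,
    fun s => ?_⟩
  have h0 : 0 ≤ |s| ^ (p - 1) := by positivity
  have h1 : 0 ≤ |FFun p μ (-1 / μ)| := abs_nonneg _
  have h2 : 0 ≤ 1 / (p * μ * (p - 1) ^ (p - 1)) := by positivity
  have h3 : 0 ≤ A / (p * μ) := by positivity
  rcases lt_or_ge (-1 / μ) s with hs | hs
  · rw [key s hs]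
    have h4 : |fFun p μ s / (p * μ)| ≤ A / (p * μ) * (1 + |s| ^ (p - 1)) := by
      rw [abs_div, abs_of_pos (by positivity : 0 < p * μ), div_mul_eq_mul_div]
      have := hA s
      gcongr
    refine (abs_sub _ _).trans ?_
    rw [abs_of_nonneg h2]
    nlinarith
  · rw [fFun_of_le hs, FFun, primitive_eq_of_le hcf (fun s hs => fFun_of_le hs) hs, ← FFun]
    simp only [zero_mul, zero_div, zero_sub, abs_neg]
    nlinarith

theorem hasDerivAt_gFun (hμ : 0 < μ) {s : ℝ} (hs : 0 < s) :
    HasDerivAt (gFun p q μ) ((p - 1) ^ (q - p + 1) / μ ^ q *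
      ((p - 1) * μ * (1 + μ * s) ^ (p - 2) * Real.log (1 + μ * s) ^ q +
        q * μ * (1 + μ * s) ^ (p - 2) * Real.log (1 + μ * s) ^ (q - 1))) s := by
  have ht : 1 < 1 + μ * s := by nlinarith
  have hl : 0 < Real.log (1 + μ * s) := Real.log_pos ht
  have h1 : HasDerivAt (fun t => 1 + μ * t) μ s := by
    simpa using ((hasDerivAt_id s).const_mul μ).const_add 1
  have h2 := (h1.rpow_const (p := p - 1) (Or.inl (by linarith))).mul
    ((h1.log (by linarith)).rpow_const (p := q) (Or.inl hl.ne'))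
  have h3 := h2.const_mul ((p - 1) ^ (q - p + 1) / μ ^ q)
  refine (h3.congr_of_eventuallyEq ?_).congr_deriv ?_
  · filter_upwards [lt_mem_nhds hs] with t ht
    exact gFun_of_pos hμ ht
  · congr 1
    have h4 : (1 + μ * s) ^ (p - 1) = (1 + μ * s) ^ (p - 2) * (1 + μ * s) := by
      rw [show p - 1 = p - 2 + 1 by ring, Real.rpow_add_one (by linarith)]
    have h5 : p - 1 - 1 = p - 2 := by ring
    rw [h4, h5]
    have h6 : 1 + μ * s ≠ 0 := by linarith
    field_simp

/-- The quantity `g(s)s/p - G(s)`. -/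
def HFun (p q μ s : ℝ) : ℝ := gFun p q μ s * s / p - GFun p q μ s

theorem hasDerivAt_GFun (hp : 1 < p) (hq : 0 < q) (hμ : 0 < μ) (s : ℝ) :
    HasDerivAt (GFun p q μ) (gFun p q μ s) s :=
  intervalIntegral.integral_hasDerivAt_right
    ((continuous_gFun hp hq hμ).intervalIntegrable _ _)
    ((continuous_gFun hp hq hμ).stronglyMeasurableAtFilter _ _)
    (continuous_gFun hp hq hμ).continuousAt

/-- Here H' = (g'(s)s - (p-1)g(s))/p. The parts of order s^(p-1) ln^q cancel, leaving a gain from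
differentiating the logarithm. -/
theorem hasDerivAt_HFun (hp : 1 < p) (hq : 0 < q) (hμ : 0 < μ) {s : ℝ} (hs : 0 < s) :
    HasDerivAt (HFun p q μ) ((p - 1) ^ (q - p + 1) / μ ^ q / p *
      ((1 + μ * s) ^ (p - 2) * Real.log (1 + μ * s) ^ (q - 1) *
        (q * (μ * s) - (p - 1) * Real.log (1 + μ * s)))) s := by
  have hp0 : p ≠ 0 := by linarith
  have ht : 1 < 1 + μ * s := by nlinarith
  have hl : 0 < Real.log (1 + μ * s) := Real.log_pos ht
  refine ((((hasDerivAt_gFun hμ hs).mul (hasDerivAt_id s)).div_const p).sub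
    (hasDerivAt_GFun hp hq hμ s)).congr_deriv ?_
  have h4 : (1 + μ * s) ^ (p - 1) = (1 + μ * s) ^ (p - 2) * (1 + μ * s) := by
    rw [show p - 1 = p - 2 + 1 by ring, Real.rpow_add_one (by linarith)]
  have h5 : Real.log (1 + μ * s) ^ q =
      Real.log (1 + μ * s) ^ (q - 1) * Real.log (1 + μ * s) := by
    rw [Real.rpow_sub_one hl.ne', div_mul_cancel₀ _ hl.ne']
  rw [gFun_of_pos hμ hs, h4, h5]
  generalize (p - 1) ^ (q - p + 1) / μ ^ q = A
  simp only [id]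
  field_simp
  ring

/-- For large s the last factor is at least q(1 + μs)/4, since the logarithm is negligible and μs is
at least half of 1 + μs. The factor ln^(q-1) may decay when q < 1, at the price of an arbitrarily
small power η. -/
theorem exists_le_deriv_HFun (hp : 1 < p) (hq : 0 < q) (hμ : 0 < μ) {η : ℝ} (hη : 0 < η)
    (hηp : η < p - 1) :
    ∃ a > 0, ∃ s₀ > 0, ∀ s ≥ s₀, a * s ^ (p - η - 1) ≤ (p - 1) ^ (q - p + 1) / μ ^ q / p *
      ((1 + μ * s) ^ (p - 2) * Real.log (1 + μ * s) ^ (q - 1) *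
        (q * (μ * s) - (p - 1) * Real.log (1 + μ * s))) := by
  have hp1 : 0 < p - 1 := by linarith
  set A := (p - 1) ^ (q - p + 1) / μ ^ q / p with hA
  have hA0 : 0 < A := by positivity
  have hlim : Tendsto (fun s : ℝ => 1 + μ * s) atTop atTop :=
    tendsto_atTop_add_const_left _ _ (tendsto_id.const_mul_atTop hμ)
  have e1 : ∀ᶠ t : ℝ in atTop, Real.log t ^ (1 - q) ≤ t ^ η := by
    filter_upwards [(isLittleO_log_rpow_rpow_atTop (1 - q) hη).bound one_pos,
      eventually_gt_atTop 1] with t h1 h2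
    have hl := Real.log_pos h2
    rwa [one_mul, Real.norm_of_nonneg (by positivity), Real.norm_of_nonneg (by positivity)] at h1
  have e2 : ∀ᶠ t : ℝ in atTop, Real.log t ≤ q / (4 * (p - 1)) * t := by
    filter_upwards [Real.isLittleO_log_id_atTop.bound (by positivity : 0 < q / (4 * (p - 1))),
      eventually_gt_atTop 1] with t h1 h2
    have hl := Real.log_pos h2
    rwa [id, Real.norm_of_nonneg hl.le, Real.norm_of_nonneg (by linarith)] at h1
  obtain ⟨s₁, h₁⟩ := eventually_atTop.1 (hlim.eventually (e1.and e2))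
  refine ⟨A * (q / 4) * μ ^ (p - η - 1), by positivity, max s₁ (1 / μ),
    lt_max_of_lt_right (by positivity), fun s hs => ?_⟩
  have hsμ : 1 ≤ μ * s := by
    have := (div_le_iff₀' hμ).1 ((le_max_right _ _).trans hs)
    linarith
  have hs0 : 0 < s := by
    by_contra h
    nlinarith
  obtain ⟨h1, h2⟩ := h₁ s ((le_max_left _ _).trans hs)
  set t := 1 + μ * s with ht
  have ht1 : 1 < t := by linarith
  have hl : 0 < Real.log t := Real.log_pos ht1
  have h3 : q / 4 * t ≤ q * (μ * s) - (p - 1) * Real.log t := by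
    have h4 : (p - 1) * Real.log t ≤ q / 4 * t := by
      calc (p - 1) * Real.log t ≤ (p - 1) * (q / (4 * (p - 1)) * t) := by gcongr
        _ = q / 4 * t := by field_simp
    nlinarith
  have h5 : t ^ (-η) ≤ Real.log t ^ (q - 1) := by
    rw [Real.rpow_neg (by linarith), show q - 1 = -(1 - q) by ring, Real.rpow_neg hl.le]
    gcongr
  have h6 : t ^ (p - 2) * t ^ (-η) * (q / 4 * t) = q / 4 * t ^ (p - η - 1) := by
    have : t ^ (p - η - 1) = t ^ (p - 2) * t ^ (-η) * t := by
      rw [← Real.rpow_add (by linarith), ← Real.rpow_add_one (by linarith)]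
      ring_nf
    rw [this]
    ring
  calc A * (q / 4) * μ ^ (p - η - 1) * s ^ (p - η - 1)
      = A * (q / 4 * (μ * s) ^ (p - η - 1)) := by
        rw [Real.mul_rpow hμ.le hs0.le]
        ring
    _ ≤ A * (q / 4 * t ^ (p - η - 1)) := by
        have : (μ * s) ^ (p - η - 1) ≤ t ^ (p - η - 1) :=
          Real.rpow_le_rpow (by positivity) (by linarith) (by linarith)
        gcongr
    _ = A * (t ^ (p - 2) * t ^ (-η) * (q / 4 * t)) := by rw [h6]
    _ ≤ _ := by gcongr

/-- Integrated form of the bound on H': the difference K of H and the power is nondecreasing beyond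
s₀, bounded on [-1/μ, s₀] by compactness, and constant to the left of -1/μ. -/
theorem exists_le_HFun (hp : 1 < p) (hq : 0 < q) (hμ : 0 < μ) {η : ℝ} (hη : 0 < η)
    (hηp : η < p - 1) :
    ∃ a > 0, ∃ C ≥ 0, ∀ s, a * (max s 0) ^ (p - η) ≤ HFun p q μ s + C := by
  obtain ⟨a, ha, s₀, hs₀, h⟩ := exists_le_deriv_HFun hp hq hμ hη hηp
  have hpη : 0 < p - η := by linarith
  have hcg := continuous_gFun hp hq hμ
  have hcG : Continuous (GFun p q μ) :=
    continuous_iff_continuousAt.2 fun s => (hasDerivAt_GFun hp hq hμ s).continuousAt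
  have hcH : Continuous (HFun p q μ) := ((hcg.mul continuous_id).div_const p).sub hcG
  set K : ℝ → ℝ := fun s => HFun p q μ s - a / (p - η) * (max s 0) ^ (p - η) with hK
  have hcK : Continuous K := hcH.sub (continuous_const.mul
    (Continuous.rpow_const (by fun_prop) fun s => Or.inr hpη.le))
  have hKd : ∀ s ≥ s₀, HasDerivAt K ((p - 1) ^ (q - p + 1) / μ ^ q / p *
      ((1 + μ * s) ^ (p - 2) * Real.log (1 + μ * s) ^ (q - 1) *
        (q * (μ * s) - (p - 1) * Real.log (1 + μ * s))) - a * s ^ (p - η - 1)) s := by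
    intro s hs
    have hs0 : 0 < s := hs₀.trans_le hs
    have h1 : HasDerivAt (fun s : ℝ => (max s 0) ^ (p - η)) ((p - η) * s ^ (p - η - 1)) s := by
      refine (Real.hasDerivAt_rpow_const (Or.inl hs0.ne')).congr_of_eventuallyEq ?_
      filter_upwards [lt_mem_nhds hs0] with t ht
      rw [max_eq_left ht.le]
    refine ((hasDerivAt_HFun hp hq hμ hs0).sub (h1.const_mul (a / (p - η)))).congr_deriv ?_
    congr 1
    field_simp
  have hmono : MonotoneOn K (Set.Ici s₀) := by
    refine monotoneOn_of_deriv_nonneg (convex_Ici s₀) hcK.continuousOn ?_ ?_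
    · intro s hs
      rw [interior_Ici] at hs
      exact (hKd s (le_of_lt hs)).differentiableAt.differentiableWithinAt
    · intro s hs
      rw [interior_Ici] at hs
      rw [(hKd s (le_of_lt hs)).deriv]
      linarith [h s (le_of_lt hs)]
  obtain ⟨B, hB⟩ := (isCompact_Icc (a := -1 / μ) (b := s₀)).exists_bound_of_continuousOn
    hcK.continuousOn
  have hneg : -1 / μ ≤ 0 := (div_neg_of_neg_of_pos (by norm_num) hμ).le
  have hlow : ∀ s, -1 / μ ≤ s → -|B| ≤ K s := by
    intro s hs
    rcases le_total s s₀ with h1 | h1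
    · have := (hB s ⟨hs, h1⟩).trans (le_abs_self B)
      exact (abs_le.1 this).1
    · have := (hB s₀ ⟨hneg.trans hs₀.le, le_rfl⟩).trans (le_abs_self B)
      exact (abs_le.1 this).1.trans (hmono Set.self_mem_Ici h1 h1)
  refine ⟨a / (p - η), by positivity, |B|, abs_nonneg B, fun s => ?_⟩
  have key : -|B| ≤ K s := by
    rcases le_total (-1 / μ) s with h1 | h1
    · exact hlow s h1
    · have h2 : K s = K (-1 / μ) := by
        simp only [hK, HFun, gFun_of_le h1, gFun_of_le (le_refl (-1 / μ)), max_eq_right hneg,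
          max_eq_right (h1.trans hneg), GFun,
          primitive_eq_of_le hcg (fun s hs => gFun_of_le hs) h1]
        simp
      rw [h2]
      exact hlow _ le_rfl
  simp only [hK] at key
  linarith

/-- G is constant to the left of -1/μ, so only the positive part of s matters; H controls no more
than that. -/
theorem exists_GFun_le (hp : 1 < p) (hq : 0 < q) (hμ : 0 < μ) {η : ℝ} (hη : 0 < η) :
    ∃ A, 0 ≤ A ∧ ∀ s, GFun p q μ s ≤ A * (1 + (max s 0) ^ (p + η)) := by
  obtain ⟨A, hA, hg⟩ := exists_abs_gFun_le hp hq hμ hη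
  have hcg := continuous_gFun hp hq hμ
  have hneg : -1 / μ < 0 := div_neg_of_neg_of_pos (by norm_num) hμ
  have hpη : p - 1 + η + 1 = p + η := by ring
  have hG : ∀ s, GFun p q μ s ≤ 2 * A * (1 + |s| ^ (p + η)) := fun s => by
    rw [← hpη]
    exact (le_abs_self _).trans (abs_primitive_le (by linarith) hA hg s)
  refine ⟨2 * A * (1 + |(-1 / μ)| ^ (p + η)), by positivity, fun s => ?_⟩
  have h0 : 0 ≤ (max s 0) ^ (p + η) := Real.rpow_nonneg (le_max_right _ _) _
  have h1 : 0 ≤ |(-1 / μ)| ^ (p + η) := by positivity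
  rcases le_total 0 s with hs | hs
  · refine (hG s).trans ?_
    rw [max_eq_left hs] at h0 ⊢
    rw [abs_of_nonneg hs]
    nlinarith [mul_nonneg hA (add_nonneg zero_le_one h0), mul_nonneg hA h1,
      mul_nonneg (mul_nonneg hA h1) h0]
  · have h2 : GFun p q μ s ≤ 2 * A * (1 + |(-1 / μ)| ^ (p + η)) := by
      rcases le_total s (-1 / μ) with h3 | h3
      · rw [GFun, primitive_eq_of_le hcg (fun s hs => gFun_of_le hs) h3]
        exact hG _
      · refine (hG s).trans ?_
        have : |s| ≤ |(-1 / μ)| := by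
          rw [abs_of_nonpos hs, abs_of_neg hneg]
          linarith
        gcongr
    refine h2.trans (le_mul_of_one_le_right (by positivity) (by linarith))

/-- `G` is controlled by `g(s)s/p - G(s)` up to small powers. -/
theorem exists_GFun_le_HFun (hp : 1 < p) (hq : 0 < q) (hμ : 0 < μ) {η : ℝ} (hη : 0 < η)
    (hηp : η < p - 1) :
    ∃ A ≥ 0, ∃ C ≥ 0, ∀ L ≥ 1, ∀ s,
      GFun p q μ s ≤ A * (1 + L ^ (2 * η) * (HFun p q μ s + C) +
        L ^ (-(2 * η)) * |s| ^ (p + 3 * η)) := by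
  obtain ⟨a, ha, C, hC, hH⟩ := exists_le_HFun hp hq hμ hη hηp
  obtain ⟨A, hA, hG⟩ := exists_GFun_le hp hq hμ hη
  have hH0 : ∀ s, 0 ≤ HFun p q μ s + C := fun s =>
    le_trans (mul_nonneg ha.le (Real.rpow_nonneg (le_max_right _ _) _)) (hH s)
  refine ⟨A * (1 + 1 / a), by positivity, C, hC, fun L hL s => ?_⟩
  have hm : 0 ≤ max s 0 := le_max_right _ _
  have hL0 : 0 < L := by linarith
  -- The power p+η from G lies between p-η, controlled by H, and p+3η, still subcritical with the
  -- weight c.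
  have h1 := Real.rpow_le_mul_rpow_add hm hL0 (by linarith : 0 < p - η)
    (by linarith : p - η ≤ p + η) (by linarith : p + η ≤ p + 3 * η)
  rw [show p + η - (p - η) = 2 * η by ring, show p + η - (p + 3 * η) = -(2 * η) by ring] at h1
  have h2 : (max s 0) ^ (p - η) ≤ 1 / a * (HFun p q μ s + C) := by
    rw [one_div, ← div_eq_inv_mul, le_div_iff₀' ha]
    exact hH s
  have h3 : (max s 0) ^ (p + 3 * η) ≤ |s| ^ (p + 3 * η) :=
    Real.rpow_le_rpow hm (max_le (le_abs_self s) (abs_nonneg s)) (by linarith)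
  have hX : 0 ≤ L ^ (2 * η) := by positivity
  have hY : 0 ≤ L ^ (-(2 * η)) := by positivity
  have h5 : 0 ≤ |s| ^ (p + 3 * η) := by positivity
  have ha' : 0 ≤ 1 / a := by positivity
  calc GFun p q μ s ≤ A * (1 + (max s 0) ^ (p + η)) := hG s
    _ ≤ A * (1 + (L ^ (2 * η) * (1 / a * (HFun p q μ s + C)) +
          L ^ (-(2 * η)) * |s| ^ (p + 3 * η))) := by
        gcongr
        refine h1.trans ?_
        gcongr
    _ ≤ A * ((1 + 1 / a) * (1 + L ^ (2 * η) * (HFun p q μ s + C) +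
        L ^ (-(2 * η)) * |s| ^ (p + 3 * η))) := by
        gcongr
        have h6 := mul_nonneg hX (hH0 s)
        have h7 := mul_nonneg hY h5
        have h8 := mul_nonneg ha' h7
        nlinarith
    _ = _ := by ring

end Nonlinearities

/-! ### Integrals with a weight in `L^k` -/

/-- Hölder with exponents k and k' = k/(k-1): the L^(k') norm of |v|^r is the r-th power of the
L^(k'r) norm of v. -/
theorem integrable_weight_rpow_and_le {α : Type*} [MeasurableSpace α] {m : Measure α} {k r B : ℝ}
    (hk : 1 < k) (hr : 0 < r) (hB : 0 ≤ B) {c v : α → ℝ} (hc : MemLp c (ENNReal.ofReal k) m)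
    (hv : AEStronglyMeasurable v m)
    (hvB : eLpNorm v (ENNReal.ofReal (k / (k - 1) * r)) m ≤ ENNReal.ofReal B) :
    Integrable (fun x => |c x| * |v x| ^ r) m ∧
      ∫ x, |c x| * |v x| ^ r ∂m ≤ (eLpNorm c (ENNReal.ofReal k) m).toReal * B ^ r := by
  have hkk : k.HolderConjugate (k / (k - 1)) := Real.HolderConjugate.conjExponent hk
  have hconj : ENNReal.HolderConjugate (ENNReal.ofReal k) (ENNReal.ofReal (k / (k - 1))) :=
    hkk.ennrealOfReal
  have hk0 : 0 < k / (k - 1) := hkk.symm.pos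
  have hpow : eLpNorm (fun x => |v x| ^ r) (ENNReal.ofReal (k / (k - 1))) m ≤
      ENNReal.ofReal (B ^ r) := by
    have h1 := eLpNorm_norm_rpow (μ := m) (p := ENNReal.ofReal (k / (k - 1))) v hr
    simp only [Real.norm_eq_abs] at h1
    rw [h1, ← ENNReal.ofReal_mul hk0.le, ← ENNReal.ofReal_rpow_of_nonneg hB hr.le]
    gcongr
  have hmeas : AEStronglyMeasurable (fun x => |v x| ^ r) m :=
    ((continuous_abs.rpow_const fun _ => Or.inr hr.le).comp_aestronglyMeasurable hv)
  have hcv : MemLp (fun x => |v x| ^ r) (ENNReal.ofReal (k / (k - 1))) m :=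
    ⟨hmeas, hpow.trans_lt ENNReal.ofReal_lt_top⟩
  have hint : Integrable (fun x => |c x| * |v x| ^ r) m := by
    have := (hc.abs).integrable_mul hcv
    exact this
  refine ⟨hint, ?_⟩
  have h2 : eLpNorm (fun x => |c x| * |v x| ^ r) 1 m ≤
      eLpNorm c (ENNReal.ofReal k) m * ENNReal.ofReal (B ^ r) := by
    have h3 := eLpNorm_smul_le_mul_eLpNorm (p := ENNReal.ofReal k)
      (q := ENNReal.ofReal (k / (k - 1))) (r := 1) hmeas hc.abs.1
    refine (h3.trans_eq ?_).trans (mul_le_mul_right hpow _)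
    congr 1
    exact eLpNorm_congr_norm_ae (Eventually.of_forall fun x => by simp)
  have h4 : ∫ x, |c x| * |v x| ^ r ∂m = (eLpNorm (fun x => |c x| * |v x| ^ r) 1 m).toReal := by
    rw [eLpNorm_one_eq_lintegral_enorm, ← integral_norm_eq_lintegral_enorm hint.1]
    refine integral_congr_ae (Eventually.of_forall fun x => ?_)
    exact (Real.norm_of_nonneg (by positivity)).symm
  rw [h4]
  have h5 := ENNReal.toReal_mono (ENNReal.mul_ne_top hc.2.ne ENNReal.ofReal_ne_top) h2
  rwa [ENNReal.toReal_mul, ENNReal.toReal_ofReal (by positivity)] at h5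

theorem one_lt_of_div_lt {N : ℕ} {p k : ℝ} (hp1 : 1 < p) (hpN : p < N) (hk : N / p < k) : 1 < k := by
  refine lt_trans ?_ hk
  rw [one_lt_div (by linarith)]
  exact hpN

namespace W0

variable {N : ℕ} {Ω : Set (EuclideanSpace ℝ (Fin N))} {p : ℝ} [Fact (1 < p)]

theorem aestronglyMeasurable (v : W0 Ω p) : AEStronglyMeasurable v (volume.restrict Ω) :=
  Lp.aestronglyMeasurable _

theorem coeFn_add_smul (u φ : W0 Ω p) (t : ℝ) :
    ∀ᵐ x ∂(volume.restrict Ω), (u + t • φ : W0 Ω p) x = u x + t * φ x := by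
  rw [map_add, map_smul]
  filter_upwards [Lp.coeFn_add (toLp u) (t • toLp φ), Lp.coeFn_smul t (toLp φ)] with x h1 h2
  rw [h1, Pi.add_apply, h2, Pi.smul_apply, smul_eq_mul]

theorem coeFn_sub (u φ : W0 Ω p) :
    ∀ᵐ x ∂(volume.restrict Ω), (u - φ : W0 Ω p) x = u x - φ x := by
  rw [map_sub]
  filter_upwards [Lp.coeFn_sub (toLp u) (toLp φ)] with x h1
  rw [h1, Pi.sub_apply]

theorem grad_add_smul (u φ : W0 Ω p) (t : ℝ) :
    ∀ᵐ x ∂(volume.restrict Ω), grad (u + t • φ) x = grad u x + t • grad φ x := by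
  rw [map_add, map_smul]
  filter_upwards [Lp.coeFn_add (grad u) (t • grad φ), Lp.coeFn_smul t (grad φ)] with x h1 h2
  rw [h1, Pi.add_apply, h2, Pi.smul_apply]

theorem grad_sub (u φ : W0 Ω p) :
    ∀ᵐ x ∂(volume.restrict Ω), grad (u - φ) x = grad u x - grad φ x := by
  rw [map_sub]
  filter_upwards [Lp.coeFn_sub (grad u) (grad φ)] with x h1
  rw [h1, Pi.sub_apply]

theorem integrable_norm_grad_rpow (v : W0 Ω p) :
    Integrable (fun x => ‖grad v x‖ ^ p) (volume.restrict Ω) := by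
  have hp1 : 1 < p := Fact.out
  have h := (Lp.memLp (grad v)).integrable_norm_rpow (by simpa using by linarith)
    ENNReal.ofReal_ne_top
  rwa [ENNReal.toReal_ofReal (by linarith)] at h

/-- The power p(1 - 1/k) = p/k' is the one for which Hölder leaves exactly the L^p norm of v, the
norm in which Rellich gives compactness. -/
theorem integral_weight_le_norm_toLp {k : ℝ} (hk1 : 1 < k) {c : EuclideanSpace ℝ (Fin N) → ℝ}
    (hc : MemLp c (ENNReal.ofReal k) (volume.restrict Ω)) (v : W0 Ω p) :
    Integrable (fun x => |c x| * |v x| ^ (p * (1 - 1 / k))) (volume.restrict Ω) ∧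
    ∫ x in Ω, |c x| * |v x| ^ (p * (1 - 1 / k)) ≤
      (eLpNorm c (ENNReal.ofReal k) (volume.restrict Ω)).toReal *
        ‖toLp v‖ ^ (p * (1 - 1 / k)) := by
  have hp1 : 1 < p := Fact.out
  have h1 : k / (k - 1) * (p * (1 - 1 / k)) = p := by
    have : k - 1 ≠ 0 := by linarith
    field_simp
  have h2 : 0 < 1 - 1 / k := by
    rw [sub_pos, div_lt_one (by linarith)]
    exact hk1
  refine integrable_weight_rpow_and_le hk1 (by nlinarith) (norm_nonneg _) hc
    v.aestronglyMeasurable ?_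
  rw [h1, Lp.norm_def, ENNReal.ofReal_toReal (Lp.eLpNorm_ne_top _)]

variable [hpN : Fact (p < N)] [hb : Fact (Bornology.IsBounded Ω)]

theorem integral_norm_grad_rpow (v : W0 Ω p) : ∫ x in Ω, ‖grad v x‖ ^ p = ‖v‖ ^ p := by
  have hp1 : 1 < p := Fact.out
  have h0 : 0 ≤ ∫ x in Ω, ‖grad v x‖ ^ p := integral_nonneg fun x => by positivity
  rw [norm_eq, Lp.norm_def, (Lp.memLp (grad v)).eLpNorm_eq_integral_rpow_norm
    (by simpa using by linarith) ENNReal.ofReal_ne_top, ENNReal.toReal_ofReal (by linarith : 0 ≤ p),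
    ENNReal.toReal_ofReal (by positivity), ← Real.rpow_mul h0, inv_mul_cancel₀ (by linarith),
    Real.rpow_one]

/-- The weighted Sobolev inequality. -/
theorem exists_integral_weight_le {k r : ℝ} (hk : N / p < k) (hr : 0 < r)
    (hrk : r * (1 / p - 1 / N) ≤ 1 - 1 / k) :
    ∃ S, 0 ≤ S ∧ ∀ c : EuclideanSpace ℝ (Fin N) → ℝ,
      MemLp c (ENNReal.ofReal k) (volume.restrict Ω) → ∀ v : W0 Ω p,
      Integrable (fun x => |c x| * |v x| ^ r) (volume.restrict Ω) ∧
      ∫ x in Ω, |c x| * |v x| ^ r ≤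
        (eLpNorm c (ENNReal.ofReal k) (volume.restrict Ω)).toReal * (S * ‖v‖ ^ r) := by
  have hk1 : 1 < k := one_lt_of_div_lt Fact.out hpN.out hk
  have hk0 : 0 < k / (k - 1) := div_pos (by linarith) (by linarith)
  obtain ⟨C, hC, h⟩ := exists_eLpNorm_le (Ω := Ω) (p := p) (t := k / (k - 1) * r)
    -- The condition on r says that k'r is at most the critical Sobolev exponent.
    (by positivity) (by
      have h1 : 1 / (k / (k - 1) * r) = (1 - 1 / k) / r := by
        have : k - 1 ≠ 0 := by linarith
        field_simp
      rw [h1, le_div_iff₀ hr]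
      linarith)
  refine ⟨C ^ r, by positivity, fun c hc v => ?_⟩
  have := integrable_weight_rpow_and_le hk1 hr (by positivity) hc v.aestronglyMeasurable (h v)
  rwa [Real.mul_rpow hC (norm_nonneg v)] at this

end W0

/-! ### Directional derivatives of the energy -/

theorem Real.rpow_eq_rpow_sub_one_mul {y r : ℝ} (hy : 0 ≤ y) (hr : 1 ≤ r) :
    y ^ r = y ^ (r - 1) * y := by
  conv_lhs => rw [show r = r - 1 + 1 by ring]
  rw [Real.rpow_add_of_nonneg hy (by linarith) zero_le_one, Real.rpow_one]

theorem growth_mul_le {A r s y z : ℝ} (hA : 0 ≤ A) (hr : 1 ≤ r) (hz : |z| ≤ y) (hs : |s| ≤ y) :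
    A * (1 + |s| ^ (r - 1)) * |z| ≤ 2 * A * (1 + y ^ r) := by
  have hy : 0 ≤ y := (abs_nonneg z).trans hz
  have h1 : y ^ r = y ^ (r - 1) * y := Real.rpow_eq_rpow_sub_one_mul hy hr
  have h2 := Real.rpow_le_one_add_rpow hy zero_le_one hr
  rw [Real.rpow_one] at h2
  have h3 : 0 ≤ y ^ r := by positivity
  calc A * (1 + |s| ^ (r - 1)) * |z| ≤ A * (1 + y ^ (r - 1)) * y := by
        have : |s| ^ (r - 1) ≤ y ^ (r - 1) :=
          Real.rpow_le_rpow (abs_nonneg s) hs (by linarith)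
        gcongr
    _ = A * (y + y ^ r) := by rw [h1]; ring
    _ ≤ A * (2 * (1 + y ^ r)) := by gcongr; linarith
    _ = _ := by ring

/-! ### Differentiation of weighted superposition integrals along lines -/

section Nemytskii

variable {α : Type*} [MeasurableSpace α] {m : Measure α} {c u φ : α → ℝ} {r A : ℝ} {g : ℝ → ℝ}

theorem integrable_weight_mul_add_rpow (hr : 0 < r) (hc : Integrable c m)
    (hu : AEStronglyMeasurable u m) (hφ : AEStronglyMeasurable φ m)
    (hcu : Integrable (fun x => |c x| * |u x| ^ r) m)
    (hcφ : Integrable (fun x => |c x| * |φ x| ^ r) m) :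
    Integrable (fun x => |c x| * (1 + (|u x| + |φ x|) ^ r)) m := by
  refine Integrable.mono' ((hc.abs.add ((hcu.add hcφ).const_mul (2 ^ r)))) ?_ ?_
  · refine hc.abs.1.mul (aestronglyMeasurable_const.add ?_)
    exact (Real.continuous_rpow_const hr.le).comp_aestronglyMeasurable
      ((continuous_abs.comp_aestronglyMeasurable hu).add
        (continuous_abs.comp_aestronglyMeasurable hφ))
  · refine Eventually.of_forall fun x => ?_
    have h1 := Real.add_rpow_le_two_rpow_mul (abs_nonneg (u x)) (abs_nonneg (φ x)) hr.le
    rw [Real.norm_of_nonneg (by positivity)]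
    simp only [Pi.add_apply]
    calc |c x| * (1 + (|u x| + |φ x|) ^ r)
        ≤ |c x| * (1 + 2 ^ r * (|u x| ^ r + |φ x| ^ r)) := by gcongr
      _ = _ := by ring

theorem integrable_weight_mul_primitive (hr : 1 ≤ r) (hA : 0 ≤ A) (hg : Continuous g)
    (hgA : ∀ s, |g s| ≤ A * (1 + |s| ^ (r - 1))) (hc : Integrable c m)
    (hu : AEStronglyMeasurable u m) (hcu : Integrable (fun x => |c x| * |u x| ^ r) m) :
    Integrable (fun x => c x * ∫ t in (0 : ℝ)..u x, g t) m := by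
  have hcG : Continuous fun s => ∫ t in (0 : ℝ)..s, g t :=
    intervalIntegral.continuous_primitive (fun a b => hg.intervalIntegrable a b) 0
  refine Integrable.mono' ((hc.abs.add hcu).const_mul (2 * A))
    (hc.1.mul (hcG.comp_aestronglyMeasurable hu)) (Eventually.of_forall fun x => ?_)
  have h1 := abs_primitive_le (by linarith) hA hgA (u x)
  rw [show r - 1 + 1 = r by ring] at h1
  rw [norm_mul, Real.norm_eq_abs, Real.norm_eq_abs]
  calc |c x| * _ ≤ |c x| * (2 * A * (1 + |u x| ^ r)) := by gcongr
    _ = _ := by simp only [Pi.add_apply]; ring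

/-- Differentiation under the integral; for |t| < 1 the derivative is dominated by a multiple of |c|
(1 + (|u| + |φ|)^r). -/
theorem hasDerivAt_integral_primitive (hr : 1 ≤ r) (hA : 0 ≤ A) (hg : Continuous g)
    (hgA : ∀ s, |g s| ≤ A * (1 + |s| ^ (r - 1))) (hc : Integrable c m)
    (hu : AEStronglyMeasurable u m) (hφ : AEStronglyMeasurable φ m)
    (hcu : Integrable (fun x => |c x| * |u x| ^ r) m)
    (hcφ : Integrable (fun x => |c x| * |φ x| ^ r) m) :
    Integrable (fun x => c x * (g (u x) * φ x)) m ∧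
      HasDerivAt (fun t : ℝ => ∫ x, c x * (∫ s in (0 : ℝ)..(u x + t * φ x), g s) ∂m)
        (∫ x, c x * (g (u x) * φ x) ∂m) 0 := by
  have hcG : Continuous fun s => ∫ t in (0 : ℝ)..s, g t :=
    intervalIntegral.continuous_primitive (fun a b => hg.intervalIntegrable a b) 0
  have key := hasDerivAt_integral_of_dominated_loc_of_deriv_le (μ := m) (x₀ := (0 : ℝ))
    (F := fun t x => c x * (∫ s in (0 : ℝ)..(u x + t * φ x), g s))
    (F' := fun t x => c x * (g (u x + t * φ x) * φ x))
    (bound := fun x => 2 * A * (|c x| * (1 + (|u x| + |φ x|) ^ r)))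
    (Metric.ball_mem_nhds (0 : ℝ) one_pos)
    (Eventually.of_forall fun t => hc.1.mul
      (hcG.comp_aestronglyMeasurable (hu.add (aestronglyMeasurable_const.mul hφ))))
    (by simpa using integrable_weight_mul_primitive hr hA hg hgA hc hu hcu)
    (hc.1.mul ((hg.comp_aestronglyMeasurable
      (hu.add (aestronglyMeasurable_const.mul hφ))).mul hφ))
    (Eventually.of_forall fun x t ht => ?_)
    ((integrable_weight_mul_add_rpow (by linarith) hc hu hφ hcu hcφ).const_mul (2 * A))
    (Eventually.of_forall fun x t _ => ?_)
  · simpa only [zero_mul, add_zero] using key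
  · have ht' : |t| ≤ 1 := by
      rw [mem_ball_zero_iff, Real.norm_eq_abs] at ht
      exact ht.le
    rw [norm_mul, norm_mul, Real.norm_eq_abs, Real.norm_eq_abs, Real.norm_eq_abs]
    have h1 : |u x + t * φ x| ≤ |u x| + |φ x| := by
      refine (abs_add_le _ _).trans ?_
      rw [abs_mul]
      have := mul_le_of_le_one_left (abs_nonneg (φ x)) ht'
      linarith
    have h2 : |φ x| ≤ |u x| + |φ x| := by linarith [abs_nonneg (u x)]
    calc |c x| * (|g (u x + t * φ x)| * |φ x|)
        ≤ |c x| * (A * (1 + |u x + t * φ x| ^ (r - 1)) * |φ x|) := by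
          gcongr
          exact hgA _
      _ ≤ |c x| * (2 * A * (1 + (|u x| + |φ x|) ^ r)) :=
          mul_le_mul_of_nonneg_left (growth_mul_le hA hr h2 h1) (abs_nonneg _)
      _ = _ := by ring
  · have h1 : HasDerivAt (fun t => u x + t * φ x) (φ x) t := by
      simpa using ((hasDerivAt_id t).mul_const (φ x)).const_add (u x)
    have h2 : HasDerivAt (fun s => ∫ t in (0 : ℝ)..s, g t) (g (u x + t * φ x)) (u x + t * φ x) :=
      intervalIntegral.integral_hasDerivAt_right (hg.intervalIntegrable _ _)
        (hg.stronglyMeasurableAtFilter _ _) hg.continuousAt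
    exact (h2.comp t h1).const_mul (c x)

end Nemytskii

theorem abs_norm_rpow_mul_inner_le {E : Type*} [NormedAddCommGroup E] [InnerProductSpace ℝ E]
    (p : ℝ) (a b : E) :
    |‖a‖ ^ (p - 2) * inner ℝ a b| ≤ ‖a‖ ^ (p - 1) * ‖b‖ := by
  rw [abs_mul, abs_of_nonneg (by positivity)]
  rcases eq_or_ne a 0 with rfl | ha
  · simp only [inner_zero_left, abs_zero, mul_zero]
    positivity
  · have h1 : ‖a‖ ^ (p - 1) = ‖a‖ ^ (p - 2) * ‖a‖ := by
      rw [← Real.rpow_add_one (norm_ne_zero_iff.2 ha)]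
      ring_nf
    rw [h1, mul_assoc]
    gcongr
    exact abs_real_inner_le_norm a b

namespace W0

variable {N : ℕ} {Ω : Set (EuclideanSpace ℝ (Fin N))} {p : ℝ} [Fact (1 < p)]

theorem hasDerivAt_integral_norm_grad_rpow (u φ : W0 Ω p) :
    Integrable (fun x => ‖grad u x‖ ^ (p - 2) * inner ℝ (grad u x) (grad φ x))
      (volume.restrict Ω) ∧
    HasDerivAt (fun t : ℝ => ∫ x in Ω, ‖grad u x + t • grad φ x‖ ^ p)
      (∫ x in Ω, p * (‖grad u x‖ ^ (p - 2) * inner ℝ (grad u x) (grad φ x))) 0 := by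
  have hp1 : 1 < p := Fact.out
  have hp0 : 0 < p := by linarith
  have hmu := Lp.aestronglyMeasurable (grad u)
  have hmφ := Lp.aestronglyMeasurable (grad φ)
  have hcp : Continuous fun a : EuclideanSpace ℝ (Fin N) => ‖a‖ ^ p :=
    continuous_norm.rpow_const fun _ => Or.inr hp0.le
  have hmF : ∀ t : ℝ, AEStronglyMeasurable
      (fun x => p * (‖grad u x + t • grad φ x‖ ^ (p - 2) *
        inner ℝ (grad u x + t • grad φ x) (grad φ x))) (volume.restrict Ω) := fun t => by
    have h1 := hmu.add (hmφ.const_smul t)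
    have h2 : AEStronglyMeasurable (fun x => ‖grad u x + t • grad φ x‖ ^ (p - 2))
        (volume.restrict Ω) := (h1.norm.aemeasurable.pow_const (p - 2)).aestronglyMeasurable
    exact aestronglyMeasurable_const.mul (h2.mul (h1.inner hmφ))
  have hbint : Integrable (fun x => p * (‖grad u x‖ + ‖grad φ x‖) ^ p) (volume.restrict Ω) := by
    refine Integrable.const_mul ?_ p
    refine Integrable.mono' (((integrable_norm_grad_rpow u).add
      (integrable_norm_grad_rpow φ)).const_mul (2 ^ p)) ?_ ?_
    · exact (Real.continuous_rpow_const hp0.le).comp_aestronglyMeasurable (hmu.norm.add hmφ.norm)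
    · refine Eventually.of_forall fun x => ?_
      rw [Real.norm_of_nonneg (by positivity)]
      exact Real.add_rpow_le_two_rpow_mul (norm_nonneg _) (norm_nonneg _) hp0.le
  have key := hasDerivAt_integral_of_dominated_loc_of_deriv_le (μ := volume.restrict Ω)
    (x₀ := (0 : ℝ)) (F := fun t x => ‖grad u x + t • grad φ x‖ ^ p)
    (F' := fun t x => p * (‖grad u x + t • grad φ x‖ ^ (p - 2) *
        inner ℝ (grad u x + t • grad φ x) (grad φ x)))
    (bound := fun x => p * (‖grad u x‖ + ‖grad φ x‖) ^ p)
    (Metric.ball_mem_nhds (0 : ℝ) one_pos)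
    (Eventually.of_forall fun t => hcp.comp_aestronglyMeasurable
      (hmu.add (hmφ.const_smul t)))
    (by simpa using integrable_norm_grad_rpow u) (hmF 0)
    (Eventually.of_forall fun x t ht => ?_) hbint
    (Eventually.of_forall fun x t _ => ?_)
  · simp only [zero_smul, add_zero] at key
    refine ⟨?_, key.2⟩
    have := key.1.const_mul p⁻¹
    refine this.congr (Eventually.of_forall fun x => ?_)
    simp only
    rw [← mul_assoc, inv_mul_cancel₀ hp0.ne', one_mul]
  · have ht' : ‖t‖ ≤ 1 := (mem_ball_zero_iff.1 ht).le
    have h1 : ‖grad u x + t • grad φ x‖ ≤ ‖grad u x‖ + ‖grad φ x‖ := by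
      refine (norm_add_le _ _).trans ?_
      rw [norm_smul]
      have := mul_le_of_le_one_left (norm_nonneg (grad φ x)) ht'
      linarith
    have h2 : ‖grad φ x‖ ≤ ‖grad u x‖ + ‖grad φ x‖ := by linarith [norm_nonneg (grad u x)]
    rw [norm_mul, Real.norm_of_nonneg hp0.le, Real.norm_eq_abs]
    refine mul_le_mul_of_nonneg_left ((abs_norm_rpow_mul_inner_le p _ _).trans ?_) hp0.le
    have h3 : (‖grad u x‖ + ‖grad φ x‖) ^ p =
        (‖grad u x‖ + ‖grad φ x‖) ^ (p - 1) * (‖grad u x‖ + ‖grad φ x‖) :=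
      Real.rpow_eq_rpow_sub_one_mul (by positivity) hp1.le
    rw [h3]
    have h4 : ‖grad u x + t • grad φ x‖ ^ (p - 1) ≤ (‖grad u x‖ + ‖grad φ x‖) ^ (p - 1) :=
      Real.rpow_le_rpow (norm_nonneg _) h1 (by linarith)
    gcongr
  · have h1 : HasDerivAt (fun t : ℝ => grad u x + t • grad φ x) (grad φ x) t := by
      simpa using ((hasDerivAt_id t).smul_const (grad φ x)).const_add (grad u x)
    have h2 := (hasFDerivAt_norm_rpow (grad u x + t • grad φ x) hp1).comp_hasDerivAt t h1
    refine h2.congr_deriv ?_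
    simp only [smul_apply, innerSL_apply_apply, smul_eq_mul]
    ring

variable [hpN : Fact (p < N)] [hb : Fact (Bornology.IsBounded Ω)]

/-- Differentiability at u is part of being a Palais–Smale sequence, so the derivative can be read
off from derivatives along the lines u + tφ. -/
theorem fderiv_energy_apply {q μ r A : ℝ} (hq : 0 < q) (hμ : 0 < μ) (hr : 1 ≤ r) (hA : 0 ≤ A)
    (hgA : ∀ s, |gFun p q μ s| ≤ A * (1 + |s| ^ (r - 1)))
    (hfA : ∀ s, |fFun p μ s| ≤ A * (1 + |s| ^ (r - 1)))
    {c h : EuclideanSpace ℝ (Fin N) → ℝ} (hc : Integrable c (volume.restrict Ω))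
    (hh : Integrable h (volume.restrict Ω))
    (hcr : ∀ v : W0 Ω p, Integrable (fun x => |c x| * |v x| ^ r) (volume.restrict Ω))
    (hhr : ∀ v : W0 Ω p, Integrable (fun x => |h x| * |v x| ^ r) (volume.restrict Ω))
    {u : W0 Ω p} (hd : DifferentiableAt ℝ (energy Ω p q μ c h) u) (φ : W0 Ω p) :
    fderiv ℝ (energy Ω p q μ c h) u φ =
      (∫ x in Ω, ‖grad u x‖ ^ (p - 2) * inner ℝ (grad u x) (grad φ x)) -
        (∫ x in Ω, c x * (gFun p q μ (u x) * φ x)) - ∫ x in Ω, h x * (fFun p μ (u x) * φ x) := by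
  have hp1 : 1 < p := Fact.out
  have hp0 : p ≠ 0 := by linarith
  have hline : HasDerivAt (fun t : ℝ => u + t • φ) φ 0 := by
    simpa using ((hasDerivAt_id (0 : ℝ)).smul_const φ).const_add u
  have h1 : HasDerivAt (fun t : ℝ => energy Ω p q μ c h (u + t • φ))
      (fderiv ℝ (energy Ω p q μ c h) u φ) 0 := by
    have hd' : HasFDerivAt (energy Ω p q μ c h) (fderiv ℝ (energy Ω p q μ c h) u)
        (u + (0 : ℝ) • φ) := by simpa using hd.hasFDerivAt
    exact hd'.comp_hasDerivAt 0 hline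
  have hG := (hasDerivAt_integral_primitive hr hA (continuous_gFun hp1 hq hμ) hgA hc
    u.aestronglyMeasurable φ.aestronglyMeasurable (hcr u) (hcr φ)).2
  have hF := (hasDerivAt_integral_primitive hr hA (continuous_fFun hp1 hμ) hfA hh
    u.aestronglyMeasurable φ.aestronglyMeasurable (hhr u) (hhr φ)).2
  have hD := (hasDerivAt_integral_norm_grad_rpow u φ).2
  have h2 := ((hD.const_mul (1 / p)).sub hG).sub hF
  have heq : (fun t : ℝ => energy Ω p q μ c h (u + t • φ)) = fun t : ℝ =>
      1 / p * (∫ x in Ω, ‖grad u x + t • grad φ x‖ ^ p) -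
        (∫ x in Ω, c x * ∫ s in (0 : ℝ)..(u x + t * φ x), gFun p q μ s) -
        ∫ x in Ω, h x * ∫ s in (0 : ℝ)..(u x + t * φ x), fFun p μ s := by
    funext t
    rw [energy]
    congr 1
    · congr 1
      · congr 1
        refine integral_congr_ae ?_
        filter_upwards [grad_add_smul u φ t] with x hx
        rw [hx]
      · refine integral_congr_ae ?_
        filter_upwards [coeFn_add_smul u φ t] with x hx
        rw [hx, GFun]
    · refine integral_congr_ae ?_
      filter_upwards [coeFn_add_smul u φ t] with x hx
      rw [hx, FFun]
  rw [heq] at h1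
  rw [h1.unique h2, integral_const_mul]
  field_simp

end W0

/-! ### Strict monotonicity of the `p`-Laplacian -/

section Monotone

variable {E : Type*} [NormedAddCommGroup E] [InnerProductSpace ℝ E] {p : ℝ}

/-- The pairing `⟨|a|^{p-2}a - |b|^{p-2}b, a - b⟩`. -/
def pMonotone (p : ℝ) (a b : E) : ℝ :=
  ‖a‖ ^ (p - 2) * inner ℝ a (a - b) - ‖b‖ ^ (p - 2) * inner ℝ b (a - b)

/-- For p < 2 the factor ‖a‖^(p-2) is singular at 0; continuity of the product comes from ‖·‖^p
being continuously differentiable. -/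
theorem continuous_norm_rpow_mul_inner (hp : 1 < p) :
    Continuous fun w : E × E => ‖w.1‖ ^ (p - 2) * inner ℝ w.1 w.2 := by
  have h1 : Continuous fun w : E × E => fderiv ℝ (fun x : E => ‖x‖ ^ p) w.1 w.2 :=
    (((contDiff_norm_rpow hp).continuous_fderiv one_ne_zero).comp continuous_fst).clm_apply
      continuous_snd
  have h2 : (fun w : E × E => ‖w.1‖ ^ (p - 2) * inner ℝ w.1 w.2) =
      fun w : E × E => p⁻¹ * fderiv ℝ (fun x : E => ‖x‖ ^ p) w.1 w.2 := by
    funext w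
    rw [fderiv_norm_rpow w.1 hp]
    simp only [smul_apply, innerSL_apply_apply, smul_eq_mul]
    field_simp
  rw [h2]
  exact continuous_const.mul h1

theorem continuous_pMonotone (hp : 1 < p) :
    Continuous fun w : E × E => pMonotone p w.1 w.2 :=
  ((continuous_norm_rpow_mul_inner hp).comp
      (continuous_fst.prodMk (continuous_fst.sub continuous_snd))).sub
    ((continuous_norm_rpow_mul_inner hp).comp
      (continuous_snd.prodMk (continuous_fst.sub continuous_snd)))

/-- For nonzero a, b the pairing is (‖a‖^(p-1) - ‖b‖^(p-1))(‖a‖ - ‖b‖) plus (‖a‖^(p-2) + ‖b‖^(p-2))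
times the Cauchy–Schwarz defect ‖a‖‖b‖ - ⟨a, b⟩. Both are nonnegative: the first is positive if the
norms differ, the second if they agree and a ≠ b. -/
theorem pMonotone_pos (hp : 1 < p) {a b : E} (hab : a ≠ b) : 0 < pMonotone p a b := by
  rcases eq_or_ne a 0 with rfl | ha
  · have hb : 0 < ‖b‖ := norm_pos_iff.2 hab.symm
    simp only [pMonotone, inner_zero_left, zero_sub, inner_neg_right,
      real_inner_self_eq_norm_sq]
    have : 0 < ‖b‖ ^ (p - 2) * ‖b‖ ^ 2 := by positivity
    linarith
  rcases eq_or_ne b 0 with rfl | hb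
  · have ha' : 0 < ‖a‖ := norm_pos_iff.2 ha
    simp only [pMonotone, inner_zero_left, sub_zero, mul_zero, real_inner_self_eq_norm_sq]
    positivity
  have hα : 0 < ‖a‖ := norm_pos_iff.2 ha
  have hβ : 0 < ‖b‖ := norm_pos_iff.2 hb
  have hT : pMonotone p a b = ‖a‖ ^ (p - 2) * ‖a‖ ^ 2 + ‖b‖ ^ (p - 2) * ‖b‖ ^ 2 -
      (‖a‖ ^ (p - 2) + ‖b‖ ^ (p - 2)) * inner ℝ a b := by
    simp only [pMonotone, inner_sub_right, real_inner_self_eq_norm_sq, real_inner_comm a b]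
    ring
  have e1 : ‖a‖ ^ (p - 1) = ‖a‖ ^ (p - 2) * ‖a‖ := by
    rw [← Real.rpow_add_one hα.ne']
    ring_nf
  have e2 : ‖b‖ ^ (p - 1) = ‖b‖ ^ (p - 2) * ‖b‖ := by
    rw [← Real.rpow_add_one hβ.ne']
    ring_nf
  have hid : ‖a‖ ^ (p - 2) * ‖a‖ ^ 2 + ‖b‖ ^ (p - 2) * ‖b‖ ^ 2 -
      (‖a‖ ^ (p - 2) + ‖b‖ ^ (p - 2)) * (‖a‖ * ‖b‖) =
      (‖a‖ ^ (p - 1) - ‖b‖ ^ (p - 1)) * (‖a‖ - ‖b‖) := by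
    rw [e1, e2]
    ring
  have hx : 0 < ‖a‖ ^ (p - 2) + ‖b‖ ^ (p - 2) := by positivity
  have hpos : ‖a‖ ≠ ‖b‖ → 0 < (‖a‖ ^ (p - 1) - ‖b‖ ^ (p - 1)) * (‖a‖ - ‖b‖) := by
    intro h
    rcases lt_or_gt_of_ne h with h | h
    · have := Real.rpow_lt_rpow hα.le h (by linarith : 0 < p - 1)
      nlinarith
    · have := Real.rpow_lt_rpow hβ.le h (by linarith : 0 < p - 1)
      nlinarith
  rw [hT]
  have hcs := real_inner_le_norm a b
  rcases eq_or_ne ‖a‖ ‖b‖ with h | h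
  · have hlt : inner ℝ a b < ‖a‖ * ‖b‖ := by
      refine lt_of_le_of_ne hcs fun heq => hab ?_
      have : ‖a - b‖ ^ 2 = 0 := by
        rw [@norm_sub_sq ℝ, RCLike.re_to_real, heq, h]
        ring
      exact sub_eq_zero.1 (norm_eq_zero.1 (pow_eq_zero_iff two_ne_zero |>.1 this))
    have h0 : (‖a‖ ^ (p - 1) - ‖b‖ ^ (p - 1)) * (‖a‖ - ‖b‖) = 0 := by rw [h]; ring
    have := mul_lt_mul_of_pos_left hlt hx
    linarith
  · have h1 := hpos h
    have := mul_le_mul_of_nonneg_left hcs hx.le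
    linarith

theorem pMonotone_nonneg (hp : 1 < p) (a b : E) : 0 ≤ pMonotone p a b := by
  rcases eq_or_ne a b with rfl | h
  · simp [pMonotone]
  · exact (pMonotone_pos hp h).le

theorem pMonotone_smul {t : ℝ} (ht : 0 < t) (a b : E) :
    pMonotone p (t • a) (t • b) = t ^ p * pMonotone p a b := by
  have h1 : t ^ p = t ^ (p - 2) * t ^ 2 := by
    rw [← Real.rpow_natCast, ← Real.rpow_add ht]
    norm_num
  simp only [pMonotone, ← smul_sub, norm_smul, Real.norm_of_nonneg ht.le, inner_smul_left,
    inner_smul_right, Real.mul_rpow ht.le (norm_nonneg _), h1]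
  simp only [conj_trivial]
  ring

/-- Both sides are homogeneous of degree p, so pairs can be normalised by ‖a‖^p + ‖b‖^p = 1. Either
‖a - b‖^p < ε, or the pair lies in a compact set on which the pairing has a positive lower bound.
This treats all p > 1 at once. -/
theorem exists_norm_sub_rpow_le [FiniteDimensional ℝ E] (hp : 1 < p) {ε : ℝ} (hε : 0 < ε) :
    ∃ C ≥ 0, ∀ a b : E, ‖a - b‖ ^ p ≤ ε * (‖a‖ ^ p + ‖b‖ ^ p) + C * pMonotone p a b := by
  have hp0 : 0 < p := by linarith
  have hcn : Continuous fun w : E × E => ‖w.1‖ ^ p + ‖w.2‖ ^ p :=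
    (continuous_fst.norm.rpow_const fun _ => Or.inr hp0.le).add
      (continuous_snd.norm.rpow_const fun _ => Or.inr hp0.le)
  have hcd : Continuous fun w : E × E => ‖w.1 - w.2‖ ^ p :=
    (continuous_fst.sub continuous_snd).norm.rpow_const fun _ => Or.inr hp0.le
  set K : Set (E × E) := {w | ‖w.1‖ ^ p + ‖w.2‖ ^ p = 1} ∩ {w | ε ≤ ‖w.1 - w.2‖ ^ p} with hK
  have hKc : IsCompact K := by
    refine Metric.isCompact_of_isClosed_isBounded
      ((isClosed_eq hcn continuous_const).inter (isClosed_le continuous_const hcd)) ?_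
    refine (Metric.isBounded_closedBall (x := (0 : E × E)) (r := 1)).subset fun w hw => ?_
    have h1 : ‖w.1‖ ^ p + ‖w.2‖ ^ p = 1 := hw.1
    have h2 : 0 ≤ ‖w.1‖ ^ p := by positivity
    have h3 : 0 ≤ ‖w.2‖ ^ p := by positivity
    rw [mem_closedBall_zero_iff, Prod.norm_def]
    refine max_le ?_ ?_
    · refine (Real.rpow_le_rpow_iff (norm_nonneg _) zero_le_one hp0).1 ?_
      rw [Real.one_rpow]
      linarith
    · refine (Real.rpow_le_rpow_iff (norm_nonneg _) zero_le_one hp0).1 ?_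
      rw [Real.one_rpow]
      linarith
  obtain ⟨m, hm, hmK⟩ := hKc.exists_forall_le' (continuous_pMonotone hp).continuousOn
    (a := 0) (fun w hw => pMonotone_pos hp fun h => by
      have h1 : ε ≤ ‖w.1 - w.2‖ ^ p := hw.2
      rw [h, sub_self, norm_zero, Real.zero_rpow hp0.ne'] at h1
      linarith)
  refine ⟨2 ^ p / m, by positivity, fun a b => ?_⟩
  have hT := pMonotone_nonneg hp a b
  have ha : 0 ≤ ‖a‖ ^ p := by positivity
  have hb : 0 ≤ ‖b‖ ^ p := by positivity
  have hsub : ‖a - b‖ ^ p ≤ 2 ^ p * (‖a‖ ^ p + ‖b‖ ^ p) :=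
    (Real.rpow_le_rpow (norm_nonneg _) (norm_sub_le a b) hp0.le).trans
      (Real.add_rpow_le_two_rpow_mul (norm_nonneg _) (norm_nonneg _) hp0.le)
  have hCT : 0 ≤ 2 ^ p / m * pMonotone p a b := by positivity
  rcases (add_nonneg ha hb).eq_or_lt with hR | hR
  · rw [← hR, mul_zero] at hsub ⊢
    linarith
  · set R := ‖a‖ ^ p + ‖b‖ ^ p with hRdef
    set t := R ^ (-(1 / p)) with ht
    have ht0 : 0 < t := Real.rpow_pos_of_pos hR _
    have htp : t ^ p = R⁻¹ := by
      rw [ht, ← Real.rpow_mul hR.le, neg_mul, one_div_mul_cancel hp0.ne', Real.rpow_neg_one]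
    have hn : ∀ x : E, ‖t • x‖ ^ p = R⁻¹ * ‖x‖ ^ p := fun x => by
      rw [norm_smul, Real.norm_of_nonneg ht0.le, Real.mul_rpow ht0.le (norm_nonneg _), htp]
    by_cases hcase : ε ≤ R⁻¹ * ‖a - b‖ ^ p
    · have hmem : (t • a, t • b) ∈ K := by
        refine ⟨?_, ?_⟩
        · change ‖t • a‖ ^ p + ‖t • b‖ ^ p = 1
          rw [hn, hn, ← mul_add, ← hRdef, inv_mul_cancel₀ hR.ne']
        · change ε ≤ ‖t • a - t • b‖ ^ p
          rwa [← smul_sub, hn]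
      have h1 := hmK _ hmem
      change m ≤ pMonotone p (t • a) (t • b) at h1
      rw [pMonotone_smul ht0, htp, ← div_eq_inv_mul, le_div_iff₀ hR] at h1
      have h2 : R ≤ pMonotone p a b / m := by
        rw [le_div_iff₀ hm]
        linarith
      have h3 : 2 ^ p * R ≤ 2 ^ p / m * pMonotone p a b := by
        calc 2 ^ p * R ≤ 2 ^ p * (pMonotone p a b / m) := by gcongr
          _ = _ := by ring
      have : 0 ≤ ε * R := by positivity
      linarith
    · rw [not_le, ← div_eq_inv_mul, div_lt_iff₀ hR] at hcase
      linarith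

end Monotone

/-! ### Boundedness of Palais–Smale sequences -/

/-- Since k > N/p, the power p satisfies the weighted Sobolev condition strictly, with gap p/N -
1/k. The second requirement leaves room for 4η between max(1, p-1) and p. -/
theorem exists_subcritical_exponent {N : ℕ} {p k : ℝ} (hp : 1 < p) (hpN : p < N) (hk : N / p < k) :
    ∃ η > 0, (p + 4 * η) * (1 / p - 1 / N) ≤ 1 - 1 / k ∧ 4 * η + max 1 (p - 1) < p := by
  have hp0 : 0 < p := by linarith
  have hN0 : (0 : ℝ) < N := by linarith
  have hk0 : 0 < k := (div_pos hN0 hp0).trans hk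
  have hD : 0 < 1 / p - 1 / N := sub_pos.2 (one_div_lt_one_div_of_lt hp0 hpN)
  have hgap : 0 < p / N - 1 / k := by
    rw [sub_pos, div_lt_div_iff₀ hk0 hN0]
    rw [div_lt_iff₀ hp0] at hk
    linarith
  have hmax : 0 < p - max 1 (p - 1) := sub_pos.2 (max_lt hp (by linarith))
  refine ⟨min ((p / N - 1 / k) / (4 * (1 / p - 1 / N))) ((p - max 1 (p - 1)) / 8),
    lt_min (by positivity) (by positivity), ?_, ?_⟩
  · have h1 := min_le_left ((p / N - 1 / k) / (4 * (1 / p - 1 / N))) ((p - max 1 (p - 1)) / 8)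
    rw [le_div_iff₀ (by positivity)] at h1
    have h2 : p * (1 / p - 1 / N) = 1 - p / N := by field_simp
    nlinarith
  · have h1 := min_le_right ((p / N - 1 / k) / (4 * (1 / p - 1 / N))) ((p - max 1 (p - 1)) / 8)
    linarith

theorem Real.le_rpow_of_mul_rpow_le {K p e C b : ℝ} (hK : 1 ≤ K) (hb : 0 < b) (he : e < p)
    (h : b * K ^ p ≤ C * K ^ e) : K ≤ (C / b) ^ (1 / (p - e)) := by
  have hK0 : 0 < K := by linarith
  have h1 : K ^ p = K ^ (p - e) * K ^ e := by rw [← Real.rpow_add hK0]; ring_nf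
  have h2 : K ^ (p - e) ≤ C / b := by
    rw [le_div_iff₀ hb]
    rw [h1, ← mul_assoc] at h
    linarith [le_of_mul_le_mul_right h (Real.rpow_pos_of_pos hK0 e)]
  calc K = (K ^ (p - e)) ^ (1 / (p - e)) := by
        rw [← Real.rpow_mul hK0.le, mul_one_div_cancel (by linarith), Real.rpow_one]
    _ ≤ _ := Real.rpow_le_rpow (by positivity) h2 (one_div_nonneg.2 (by linarith))

namespace W0

variable {N : ℕ} {Ω : Set (EuclideanSpace ℝ (Fin N))} {p : ℝ} [Fact (1 < p)]

theorem abs_integral_weight_le {m : Measure (EuclideanSpace ℝ (Fin N))}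
    {h w v : EuclideanSpace ℝ (Fin N) → ℝ} {A r : ℝ}
    (hw : ∀ x, |w x| ≤ A * (1 + |v x| ^ r)) (hh : Integrable h m)
    (hv : Integrable (fun x => |h x| * |v x| ^ r) m) :
    |∫ x, h x * w x ∂m| ≤ A * (∫ x, |h x| ∂m + ∫ x, |h x| * |v x| ^ r ∂m) := by
  rw [← integral_add hh.abs hv, ← integral_const_mul, ← Real.norm_eq_abs]
  refine norm_integral_le_of_norm_le ((hh.abs.add hv).const_mul A) (Eventually.of_forall fun x => ?_)
  rw [norm_mul, Real.norm_eq_abs, Real.norm_eq_abs]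
  calc |h x| * |w x| ≤ |h x| * (A * (1 + |v x| ^ r)) :=
        mul_le_mul_of_nonneg_left (hw x) (abs_nonneg _)
    _ = _ := by ring

variable [hpN : Fact (p < N)] [hb : Fact (Bornology.IsBounded Ω)]

/-- The combination I(u) - I'(u)u/p removes the gradient term. -/
theorem integral_weight_HFun_eq {q μ r A : ℝ} (hq : 0 < q) (hμ : 0 < μ) (hr : 1 ≤ r) (hA : 0 ≤ A)
    (hgA : ∀ s, |gFun p q μ s| ≤ A * (1 + |s| ^ (r - 1)))
    (hfA : ∀ s, |fFun p μ s| ≤ A * (1 + |s| ^ (r - 1)))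
    {c h : EuclideanSpace ℝ (Fin N) → ℝ} (hc : Integrable c (volume.restrict Ω))
    (hh : Integrable h (volume.restrict Ω))
    (hcr : ∀ v : W0 Ω p, Integrable (fun x => |c x| * |v x| ^ r) (volume.restrict Ω))
    (hhr : ∀ v : W0 Ω p, Integrable (fun x => |h x| * |v x| ^ r) (volume.restrict Ω))
    {u : W0 Ω p} (hd : DifferentiableAt ℝ (energy Ω p q μ c h) u) :
    Integrable (fun x => c x * HFun p q μ (u x)) (volume.restrict Ω) ∧
    ∫ x in Ω, c x * HFun p q μ (u x) = energy Ω p q μ c h u -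
      fderiv ℝ (energy Ω p q μ c h) u u / p -
      ∫ x in Ω, h x * (fFun p μ (u x) * u x / p - FFun p μ (u x)) := by
  have hp1 : 1 < p := Fact.out
  have hp0 : p ≠ 0 := by linarith
  have hum := u.aestronglyMeasurable
  have icg := (hasDerivAt_integral_primitive hr hA (continuous_gFun hp1 hq hμ) hgA hc
    hum hum (hcr u) (hcr u)).1
  have icG : Integrable (fun x => c x * GFun p q μ (u x)) (volume.restrict Ω) :=
    integrable_weight_mul_primitive hr hA (continuous_gFun hp1 hq hμ) hgA hc hum (hcr u)
  have ihf := (hasDerivAt_integral_primitive hr hA (continuous_fFun hp1 hμ) hfA hh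
    hum hum (hhr u) (hhr u)).1
  have ihF : Integrable (fun x => h x * FFun p μ (u x)) (volume.restrict Ω) :=
    integrable_weight_mul_primitive hr hA (continuous_fFun hp1 hμ) hfA hh hum (hhr u)
  have e1 : (fun x => c x * HFun p q μ (u x)) = fun x =>
      1 / p * (c x * (gFun p q μ (u x) * u x)) - c x * GFun p q μ (u x) := by
    funext x
    rw [HFun]
    ring
  have e2 : (fun x => h x * (fFun p μ (u x) * u x / p - FFun p μ (u x))) = fun x =>
      1 / p * (h x * (fFun p μ (u x) * u x)) - h x * FFun p μ (u x) := by
    funext x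
    ring
  have e3 : ∫ x in Ω, ‖grad u x‖ ^ (p - 2) * inner ℝ (grad u x) (grad u x) =
      ∫ x in Ω, ‖grad u x‖ ^ p := by
    refine integral_congr_ae (Eventually.of_forall fun x => ?_)
    simp only
    rw [real_inner_self_eq_norm_sq]
    rcases eq_or_ne ‖grad u x‖ 0 with h0 | h0
    · rw [h0, Real.zero_rpow hp0]
      simp
    · rw [← Real.rpow_natCast, ← Real.rpow_add (lt_of_le_of_ne (norm_nonneg _) h0.symm)]
      norm_num
  rw [e1, e2]
  refine ⟨(icg.const_mul _).sub icG, ?_⟩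
  rw [integral_sub (icg.const_mul _) icG, integral_sub (ihf.const_mul _) ihF, integral_const_mul,
    integral_const_mul, fderiv_energy_apply hq hμ hr hA hgA hfA hc hh hcr hhr hd, e3, energy]
  ring

end W0

namespace W0

variable {N : ℕ} {Ω : Set (EuclideanSpace ℝ (Fin N))} {p : ℝ} [Fact (1 < p)]

variable [hpN : Fact (p < N)] [hb : Fact (Bornology.IsBounded Ω)]

/-- The a priori bound. For K = ‖u‖ ≥ 1 each term of the energy except K^p/p and the h-term is
O(K^e) with e < p, and the h-term takes at most half of K^p/p beyond O(K^e). -/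
theorem exists_norm_le_of_energy_le {q μ k η A AF : ℝ} (hq : 0 < q) (hμ : 0 < μ)
    (hk : N / p < k) (hη : 0 < η) (hηk : (p + 4 * η) * (1 / p - 1 / N) ≤ 1 - 1 / k)
    (hηp : 4 * η + max 1 (p - 1) < p) (hA : 0 ≤ A) (hAF : 0 ≤ AF)
    (hgA : ∀ s, |gFun p q μ s| ≤ A * (1 + |s| ^ (p + 3 * η - 1)))
    (hfA : ∀ s, |fFun p μ s| ≤ A * (1 + |s| ^ (p + 3 * η - 1)))
    (hF : ∀ s, |FFun p μ s| ≤ AF * (1 + |s| ^ p))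
    {c h : EuclideanSpace ℝ (Fin N) → ℝ}
    (hc : MemLp c (ENNReal.ofReal k) (volume.restrict Ω))
    (hh : MemLp h (ENNReal.ofReal k) (volume.restrict Ω))
    (hc0 : ∀ᵐ x ∂(volume.restrict Ω), 0 ≤ c x)
    (hSP : ∀ v : W0 Ω p, Integrable (fun x => |h x| * |v x| ^ p) (volume.restrict Ω) ∧
      AF * ∫ x in Ω, |h x| * |v x| ^ p ≤ 1 / (2 * p) * ‖v‖ ^ p) (B : ℝ) :
    ∃ M : ℝ, ∀ u : W0 Ω p, DifferentiableAt ℝ (energy Ω p q μ c h) u →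
      |energy Ω p q μ c h u| ≤ B → ‖fderiv ℝ (energy Ω p q μ c h) u‖ ≤ B → ‖u‖ ≤ M := by
  have hp1 : 1 < p := Fact.out
  have hp0 : 0 < p := by linarith
  have hD : 0 < 1 / p - 1 / (N : ℝ) := sub_pos.2 (one_div_lt_one_div_of_lt hp0 hpN.out)
  have hk1 : 1 < k := one_lt_of_div_lt hp1 hpN.out hk
  have := isFiniteMeasure_restrict hb.out
  have hk1' : (1 : ℝ≥0∞) ≤ ENNReal.ofReal k := ENNReal.one_le_ofReal.2 hk1.le
  have hci := hc.integrable hk1'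
  have hhi := hh.integrable hk1'
  set a := max 1 (p - 1) with ha
  have ha1 : 1 ≤ a := le_max_left _ _
  have hap : p - 1 ≤ a := le_max_right _ _
  -- The two exponents produced by the interpolation with L = K².
  set e := max (4 * η + a) (p - η) with he
  have he1 : 4 * η + a ≤ e := le_max_left _ _
  have he2 : p - η ≤ e := le_max_right _ _
  have hep : e < p := max_lt hηp (by linarith)
  obtain ⟨Sr, hSr0, hSr⟩ := exists_integral_weight_le (Ω := Ω) (p := p) hk
    (r := p + 3 * η) (by linarith) (le_trans (by gcongr; norm_num) hηk)
  obtain ⟨Sa, hSa0, hSa⟩ := exists_integral_weight_le (Ω := Ω) (p := p) hk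
    (r := a) (by linarith) (le_trans (mul_le_mul_of_nonneg_right (by linarith) hD.le) hηk)
  obtain ⟨A₁, hA₁, hfF⟩ := exists_abs_fFun_mul_sub_le hp1 hμ
  obtain ⟨A₂, hA₂, C, hC, hGH⟩ := exists_GFun_le_HFun hp1 hq hμ hη
    (by linarith : η < p - 1)
  have hfF' : ∀ s, |fFun p μ s * s / p - FFun p μ s| ≤ 2 * A₁ * (1 + |s| ^ a) := fun s => by
    refine (hfF s).trans ?_
    have h1 := Real.rpow_le_one_add_rpow (abs_nonneg s) (by linarith : 0 ≤ p - 1) hap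
    have h2 : 0 ≤ |s| ^ a := by positivity
    calc A₁ * (1 + |s| ^ (p - 1)) ≤ A₁ * (2 * (1 + |s| ^ a)) := by gcongr; linarith
      _ = _ := by ring
  set hI := ∫ x in Ω, |h x| with hhI
  set cI := ∫ x in Ω, c x with hcI
  have hI0 : 0 ≤ hI := integral_nonneg fun x => abs_nonneg _
  have cI0 : 0 ≤ cI := integral_nonneg_of_ae hc0
  set nc := (eLpNorm c (ENNReal.ofReal k) (volume.restrict Ω)).toReal with hnc
  set nh := (eLpNorm h (ENNReal.ofReal k) (volume.restrict Ω)).toReal with hnh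
  have nc0 : 0 ≤ nc := ENNReal.toReal_nonneg
  have nh0 : 0 ≤ nh := ENNReal.toReal_nonneg
  set C₁ := 2 * B + 2 * A₁ * (hI + nh * Sa) with hC₁
  set C₂ := A₂ * (cI + (C₁ + C * cI) + nc * Sr) with hC₂
  refine ⟨max 1 (((B + C₂ + AF * hI) / (1 / (2 * p))) ^ (1 / (p - e))), fun u hd hE hE' => ?_⟩
  rcases le_total ‖u‖ 1 with hu1 | hK
  · exact le_max_of_le_left hu1
  refine le_max_of_le_right ?_
  have hB : 0 ≤ B := (abs_nonneg _).trans hE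
  set K := ‖u‖ with hKdef
  have hK0 : 0 < K := by linarith
  have hKmono : ∀ {x y : ℝ}, x ≤ y → K ^ x ≤ K ^ y := fun h =>
    Real.rpow_le_rpow_of_exponent_le hK h
  have hKa : 1 ≤ K ^ a := Real.one_le_rpow hK (by linarith)
  have hKKa : K ≤ K ^ a := by simpa using hKmono ha1
  have hKe : 1 ≤ K ^ e := Real.one_le_rpow hK (by linarith)
  obtain ⟨iH, eH⟩ := integral_weight_HFun_eq hq hμ (by linarith) hA hgA hfA hci hhi
    (fun v => (hSr c hc v).1) (fun v => (hSr h hh v).1) hd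
  have iG : Integrable (fun x => c x * GFun p q μ (u x)) (volume.restrict Ω) :=
    integrable_weight_mul_primitive (by linarith) hA (continuous_gFun hp1 hq hμ) hgA hci
      u.aestronglyMeasurable (hSr c hc u).1
  have hR : |∫ x in Ω, h x * (fFun p μ (u x) * u x / p - FFun p μ (u x))| ≤
      2 * A₁ * (hI + nh * (Sa * K ^ a)) := by
    refine (abs_integral_weight_le (fun x => hfF' (u x)) hhi (hSa h hh u).1).trans ?_
    have := (hSa h hh u).2
    gcongr
  have hX : ∫ x in Ω, c x * HFun p q μ (u x) ≤ C₁ * K ^ a := by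
    have h1 : |fderiv ℝ (energy Ω p q μ c h) u u / p| ≤ B * K := by
      rw [abs_div, abs_of_pos hp0]
      refine (div_le_self (abs_nonneg _) hp1.le).trans ?_
      have := (fderiv ℝ (energy Ω p q μ c h) u).le_opNorm u
      rw [Real.norm_eq_abs] at this
      refine this.trans ?_
      gcongr
    have h2 := neg_abs_le (fderiv ℝ (energy Ω p q μ c h) u u / p)
    have h3 := neg_abs_le (∫ x in Ω, h x * (fFun p μ (u x) * u x / p - FFun p μ (u x)))
    have h4 := le_abs_self (energy Ω p q μ c h u)
    have h5 : B * K ≤ B * K ^ a := by gcongr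
    have h6 : B ≤ B * K ^ a := le_mul_of_one_le_right hB hKa
    have h7 : 2 * A₁ * (hI + nh * (Sa * K ^ a)) ≤ 2 * A₁ * (hI + nh * Sa) * K ^ a := by
      have : hI ≤ hI * K ^ a := le_mul_of_one_le_right hI0 hKa
      calc 2 * A₁ * (hI + nh * (Sa * K ^ a)) ≤ 2 * A₁ * (hI * K ^ a + nh * (Sa * K ^ a)) := by
            gcongr
        _ = _ := by ring
    have h8 : C₁ * K ^ a = B * K ^ a + B * K ^ a + 2 * A₁ * (hI + nh * Sa) * K ^ a := by
      rw [hC₁]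
      ring
    rw [eH, h8]
    linarith
  have hY : ∫ x in Ω, c x * GFun p q μ (u x) ≤ C₂ * K ^ e := by
    -- L = K² turns L^(2η) K^a into K^(4η+a) and L^(-2η) K^(p+3η) into K^(p-η).
    have hL : 1 ≤ K ^ (2 : ℝ) := Real.one_le_rpow hK (by norm_num)
    have hL1 : (K ^ (2 : ℝ)) ^ (2 * η) = K ^ (4 * η) := by
      rw [← Real.rpow_mul hK0.le]
      ring_nf
    have hL2 : (K ^ (2 : ℝ)) ^ (-(2 * η)) = K ^ (-(4 * η)) := by
      rw [← Real.rpow_mul hK0.le]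
      ring_nf
    have i1 : Integrable (fun x => c x * HFun p q μ (u x) + C * c x) (volume.restrict Ω) :=
      iH.add (hci.const_mul C)
    have i2 : Integrable (fun x => K ^ (4 * η) * (c x * HFun p q μ (u x) + C * c x))
      (volume.restrict Ω) := i1.const_mul _
    have i3 : Integrable (fun x => K ^ (-(4 * η)) * (|c x| * |u x| ^ (p + 3 * η)))
      (volume.restrict Ω) := (hSr c hc u).1.const_mul _
    have i4 : Integrable (fun x => K ^ (4 * η) * (c x * HFun p q μ (u x) + C * c x) +
      K ^ (-(4 * η)) * (|c x| * |u x| ^ (p + 3 * η))) (volume.restrict Ω) := i2.add i3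
    have h1 : ∫ x in Ω, c x * GFun p q μ (u x) ≤ ∫ x in Ω, A₂ * (c x + (K ^ (4 * η) *
        (c x * HFun p q μ (u x) + C * c x) +
        K ^ (-(4 * η)) * (|c x| * |u x| ^ (p + 3 * η)))) := by
      refine integral_mono_ae iG ((hci.add i4).const_mul A₂) ?_
      filter_upwards [hc0] with x hx
      have h2 := mul_le_mul_of_nonneg_left (hGH _ hL (u x)) hx
      rw [hL1, hL2] at h2
      rw [abs_of_nonneg hx]
      refine h2.trans_eq ?_
      ring
    rw [integral_const_mul, integral_add hci i4, integral_add i2 i3, integral_const_mul,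
      integral_const_mul, integral_add iH (hci.const_mul C), integral_const_mul] at h1
    refine h1.trans ?_
    have hC₁0 : 0 ≤ C₁ := by positivity
    have h3 : K ^ (4 * η) * ((∫ x in Ω, c x * HFun p q μ (u x)) + C * cI) ≤
        (C₁ + C * cI) * K ^ e := by
      calc _ ≤ K ^ (4 * η) * (C₁ * K ^ a + C * cI * K ^ a) := by
            have : C * cI ≤ C * cI * K ^ a := le_mul_of_one_le_right (by positivity) hKa
            gcongr
        _ = (C₁ + C * cI) * K ^ (4 * η + a) := by
            rw [Real.rpow_add hK0]
            ring
        _ ≤ _ := mul_le_mul_of_nonneg_left (hKmono he1) (by positivity)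
    have h4 : K ^ (-(4 * η)) * ∫ x in Ω, |c x| * |u x| ^ (p + 3 * η) ≤ nc * Sr * K ^ e := by
      calc _ ≤ K ^ (-(4 * η)) * (nc * (Sr * K ^ (p + 3 * η))) := by
            have := (hSr c hc u).2
            gcongr
        _ = nc * Sr * K ^ (p - η) := by
            have : K ^ (p - η) = K ^ (-(4 * η)) * K ^ (p + 3 * η) := by
              rw [← Real.rpow_add hK0]
              ring_nf
            rw [this]
            ring
        _ ≤ _ := mul_le_mul_of_nonneg_left (hKmono he2) (by positivity)
    have h5 : cI ≤ cI * K ^ e := le_mul_of_one_le_right cI0 hKe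
    calc _ ≤ A₂ * (cI * K ^ e + ((C₁ + C * cI) * K ^ e + nc * Sr * K ^ e)) := by gcongr
      _ = _ := by rw [hC₂]; ring
  have hZ : |∫ x in Ω, h x * FFun p μ (u x)| ≤ AF * hI * K ^ e + 1 / (2 * p) * K ^ p := by
    refine (abs_integral_weight_le (fun x => hF (u x)) hhi (hSP u).1).trans ?_
    have h1 := (hSP u).2
    have h2 : AF * hI ≤ AF * hI * K ^ e := le_mul_of_one_le_right (by positivity) hKe
    linarith
  have hEK : energy Ω p q μ c h u = 1 / p * K ^ p - (∫ x in Ω, c x * GFun p q μ (u x)) -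
      ∫ x in Ω, h x * FFun p μ (u x) := by
    rw [energy, integral_norm_grad_rpow]
  refine Real.le_rpow_of_mul_rpow_le hK (by positivity) hep ?_
  have h1 := le_abs_self (energy Ω p q μ c h u)
  have h2 := le_abs_self (∫ x in Ω, h x * FFun p μ (u x))
  have h3 : B ≤ B * K ^ e := le_mul_of_one_le_right hB hKe
  have h4 : 1 / p * K ^ p = 1 / (2 * p) * K ^ p + 1 / (2 * p) * K ^ p := by
    field_simp
    ring
  have h5 : (B + C₂ + AF * hI) * K ^ e = B * K ^ e + C₂ * K ^ e + AF * hI * K ^ e := by ring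
  linarith

end W0

/-! ### Strong convergence of bounded Palais–Smale sequences -/

/-- A Young inequality with parameter t, by comparing d with t(1 + x). -/
theorem one_add_rpow_mul_le {x d r t : ℝ} (hx : 0 ≤ x) (hd : 0 ≤ d) (hr : 1 ≤ r) (ht : 0 < t) :
    (1 + x ^ (r - 1)) * d ≤ 2 * t * (1 + x) ^ r + 2 * t ^ (1 - r) * d ^ r := by
  have hx1 : 0 < 1 + x := by linarith
  have h0 : 1 + x ^ (r - 1) ≤ 2 * (1 + x) ^ (r - 1) := by
    have h1 : 1 ≤ (1 + x) ^ (r - 1) := Real.one_le_rpow (by linarith) (by linarith)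
    have h2 : x ^ (r - 1) ≤ (1 + x) ^ (r - 1) := Real.rpow_le_rpow hx (by linarith) (by linarith)
    linarith
  have p1 : 0 ≤ 2 * t * (1 + x) ^ r := by positivity
  have p2 : 0 ≤ 2 * t ^ (1 - r) * d ^ r := by positivity
  rcases le_total d (t * (1 + x)) with h | h
  · have : (1 + x ^ (r - 1)) * d ≤ 2 * t * (1 + x) ^ r := by
      calc (1 + x ^ (r - 1)) * d ≤ 2 * (1 + x) ^ (r - 1) * (t * (1 + x)) := by gcongr
        _ = 2 * t * ((1 + x) ^ (r - 1) * (1 + x)) := by ring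
        _ = _ := by rw [← Real.rpow_eq_rpow_sub_one_mul hx1.le hr]
    linarith
  · have : (1 + x ^ (r - 1)) * d ≤ 2 * t ^ (1 - r) * d ^ r := by
      have h3 : 1 + x ≤ d / t := by
        rw [le_div_iff₀ ht]
        linarith
      have h4 : (1 + x) ^ (r - 1) ≤ (d / t) ^ (r - 1) :=
        Real.rpow_le_rpow hx1.le h3 (by linarith)
      calc (1 + x ^ (r - 1)) * d ≤ 2 * (1 + x) ^ (r - 1) * d := by gcongr
        _ ≤ 2 * (d / t) ^ (r - 1) * d := by gcongr
        _ = 2 * t ^ (1 - r) * (d ^ (r - 1) * d) := by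
          rw [Real.div_rpow hd ht.le, show 1 - r = -(r - 1) by ring, Real.rpow_neg ht.le]
          field_simp
        _ = _ := by rw [← Real.rpow_eq_rpow_sub_one_mul hd hr]
    linarith

namespace W0

variable {N : ℕ} {Ω : Set (EuclideanSpace ℝ (Fin N))} {p : ℝ} [Fact (1 < p)]

theorem integral_pMonotone_eq (u v : W0 Ω p) :
    Integrable (fun x => pMonotone p (grad u x) (grad v x)) (volume.restrict Ω) ∧
    ∫ x in Ω, pMonotone p (grad u x) (grad v x) =
      (∫ x in Ω, ‖grad u x‖ ^ (p - 2) * inner ℝ (grad u x) (grad (u - v) x)) -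
        ∫ x in Ω, ‖grad v x‖ ^ (p - 2) * inner ℝ (grad v x) (grad (u - v) x) := by
  have i1 := (hasDerivAt_integral_norm_grad_rpow u (u - v)).1
  have i2 := (hasDerivAt_integral_norm_grad_rpow v (u - v)).1
  have hae : (fun x => ‖grad u x‖ ^ (p - 2) * inner ℝ (grad u x) (grad (u - v) x) -
      ‖grad v x‖ ^ (p - 2) * inner ℝ (grad v x) (grad (u - v) x)) =ᵐ[volume.restrict Ω]
      fun x => pMonotone p (grad u x) (grad v x) := by
    filter_upwards [grad_sub u v] with x hx
    rw [hx, pMonotone]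
  refine ⟨(i1.sub i2).congr hae, ?_⟩
  rw [← integral_sub i1 i2]
  exact (integral_congr_ae hae).symm

variable [hpN : Fact (p < N)] [hb : Fact (Bornology.IsBounded Ω)]

/-- The Nemytskii terms are small if the second factor is small in `L^p`. -/
theorem exists_abs_integral_mul_le {k r r' A M ε : ℝ} (hk : N / p < k) (hpr : p ≤ r)
    (hrr' : r < r') (hr'k : r' * (1 / p - 1 / N) ≤ 1 - 1 / k) (hA : 0 ≤ A)
    {c : EuclideanSpace ℝ (Fin N) → ℝ} (hc : MemLp c (ENNReal.ofReal k) (volume.restrict Ω))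
    (hM : 0 ≤ M) (hε : 0 < ε) :
    ∃ θ > 0, ∀ g : ℝ → ℝ, (∀ s, |g s| ≤ A * (1 + |s| ^ (r - 1))) → ∀ y d : W0 Ω p,
      ‖y‖ ≤ M → ‖d‖ ≤ 2 * M → ‖toLp d‖ < θ → |∫ x in Ω, c x * (g (y x) * d x)| ≤ ε := by
  have hp1 : 1 < p := Fact.out
  have hp0 : 0 < p := by linarith
  have hr1 : 1 ≤ r := by linarith
  have hD : 0 < 1 / p - 1 / (N : ℝ) := sub_pos.2 (one_div_lt_one_div_of_lt hp0 hpN.out)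
  have hk1 : 1 < k := one_lt_of_div_lt hp1 hpN.out hk
  have := isFiniteMeasure_restrict hb.out
  have hci := hc.integrable (ENNReal.one_le_ofReal.2 hk1.le)
  have hk' : 0 < 1 - 1 / k := by
    rw [sub_pos, div_lt_one (by linarith)]
    exact hk1
  obtain ⟨S, hS0, hS⟩ := exists_integral_weight_le (Ω := Ω) (p := p) hk (r := r) (by linarith)
    (le_trans (mul_le_mul_of_nonneg_right hrr'.le hD.le) hr'k)
  obtain ⟨S', hS'0, hS'⟩ := exists_integral_weight_le (Ω := Ω) (p := p) hk (r := r')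
    (by linarith) hr'k
  -- The power of d whose weighted integral is controlled by the L^p norm.
  set σ := p * (1 - 1 / k) with hσ
  have hσ0 : 0 < σ := by positivity
  have hσr : σ ≤ r := by
    have : 0 < 1 / k := by positivity
    nlinarith
  set nc := (eLpNorm c (ENNReal.ofReal k) (volume.restrict Ω)).toReal with hnc
  have nc0 : 0 ≤ nc := ENNReal.toReal_nonneg
  set cI := ∫ x in Ω, |c x| with hcI
  have cI0 : 0 ≤ cI := integral_nonneg fun x => abs_nonneg _
  set B₁ := 2 ^ r * (cI + nc * (S * M ^ r)) with hB₁
  set B₂ := nc * (S' * (2 * M) ^ r') with hB₂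
  have hB₁0 : 0 ≤ B₁ := by positivity
  have hB₂0 : 0 ≤ B₂ := by positivity
  -- The parameters are chosen in the order t, L, θ. First t makes the part containing y small,
  -- using ‖y‖ ≤ M; |d|^r then carries a large constant T and is split into powers r' and σ.
  obtain ⟨t, ht, htε⟩ : ∃ t > 0, A * (2 * t * B₁) ≤ ε / 3 := by
    refine ⟨ε / (6 * (A * B₁ + 1)), by positivity, ?_⟩
    have h1 : A * (2 * (ε / (6 * (A * B₁ + 1))) * B₁) = ε / 3 * (A * B₁ / (A * B₁ + 1)) := by
      field_simp
      ring
    rw [h1]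
    refine mul_le_of_le_one_right (by positivity) ?_
    rw [div_le_one (by positivity)]
    linarith
  set T := A * (2 * t ^ (1 - r)) with hT
  have hT0 : 0 ≤ T := by positivity
  -- The exponent r - r' is negative, so a large L makes the r'-part small, using ‖d‖ ≤ 2M.
  obtain ⟨L, hL, hLε⟩ : ∃ L > 0, T * (L ^ (r - r') * B₂) ≤ ε / 3 := by
    have h1 : Tendsto (fun L : ℝ => T * (L ^ (r - r') * B₂)) atTop (𝓝 0) := by
      have := (tendsto_rpow_neg_atTop (by linarith : 0 < r' - r)).mul_const B₂ |>.const_mul T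
      simpa [neg_sub] using this
    obtain ⟨L, hL1, hL2⟩ := ((h1.eventually_le_const (by positivity : 0 < ε / 3)).and
      (eventually_gt_atTop 0)).exists
    exact ⟨L, hL2, hL1⟩
  -- With t and L fixed, the σ-part is small once d is small in L^p. None of the choices depends on
  -- g beyond its growth constant A.
  obtain ⟨θ, hθ, hθε⟩ : ∃ θ > 0, T * (L ^ (r - σ) * (nc * θ ^ σ)) ≤ ε / 3 := by
    have hcont : Continuous fun θ : ℝ => T * (L ^ (r - σ) * (nc * θ ^ σ)) := by
      have := Real.continuous_rpow_const hσ0.le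
      fun_prop
    have h1 : Tendsto (fun θ : ℝ => T * (L ^ (r - σ) * (nc * θ ^ σ))) (𝓝[>] 0) (𝓝 0) := by
      have := (hcont.tendsto 0).mono_left (nhdsWithin_le_nhds (s := Set.Ioi 0))
      simpa [Real.zero_rpow hσ0.ne'] using this
    obtain ⟨θ, hθ1, hθ2⟩ := ((h1.eventually_le_const (by positivity : 0 < ε / 3)).and
      self_mem_nhdsWithin).exists
    exact ⟨θ, hθ2, hθ1⟩
  refine ⟨θ, hθ, fun g hg y d hy hd hdθ => ?_⟩
  obtain ⟨iy, ey⟩ := hS c hc y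
  obtain ⟨id', ed'⟩ := hS' c hc d
  obtain ⟨iσ, eσ⟩ := integral_weight_le_norm_toLp hk1 hc d
  have hpt : ∀ x, ‖c x * (g (y x) * d x)‖ ≤
      A * (2 * t) * (2 ^ r * (|c x| + |c x| * |y x| ^ r)) +
        (T * L ^ (r - r') * (|c x| * |d x| ^ r') + T * L ^ (r - σ) * (|c x| * |d x| ^ σ)) := by
    intro x
    rw [norm_mul, norm_mul, Real.norm_eq_abs, Real.norm_eq_abs, Real.norm_eq_abs]
    have h1 := one_add_rpow_mul_le (abs_nonneg (y x)) (abs_nonneg (d x)) hr1 ht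
    have h2 := Real.add_rpow_le_two_rpow_mul zero_le_one (abs_nonneg (y x)) (by linarith : 0 ≤ r)
    rw [Real.one_rpow] at h2
    have h3 := Real.rpow_le_mul_rpow_add (abs_nonneg (d x)) hL hσ0 hσr hrr'.le
    calc |c x| * (|g (y x)| * |d x|)
        ≤ |c x| * (A * (1 + |y x| ^ (r - 1)) * |d x|) := by
          gcongr
          exact hg _
      _ = |c x| * (A * ((1 + |y x| ^ (r - 1)) * |d x|)) := by ring
      _ ≤ |c x| * (A * (2 * t * (2 ^ r * (1 + |y x| ^ r)) + 2 * t ^ (1 - r) *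
          (L ^ (r - σ) * |d x| ^ σ + L ^ (r - r') * |d x| ^ r'))) := by
          refine mul_le_mul_of_nonneg_left (mul_le_mul_of_nonneg_left (h1.trans ?_) hA)
            (abs_nonneg _)
          gcongr
      _ = _ := by
          rw [hT]
          ring
  have i1 : Integrable (fun x => A * (2 * t) * (2 ^ r * (|c x| + |c x| * |y x| ^ r)))
      (volume.restrict Ω) := ((hci.abs.add iy).const_mul _).const_mul _
  have i2 : Integrable (fun x => T * L ^ (r - r') * (|c x| * |d x| ^ r')) (volume.restrict Ω) :=
    id'.const_mul _
  have i3 : Integrable (fun x => T * L ^ (r - σ) * (|c x| * |d x| ^ σ)) (volume.restrict Ω) :=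
    iσ.const_mul _
  have i23 : Integrable (fun x => T * L ^ (r - r') * (|c x| * |d x| ^ r') +
      T * L ^ (r - σ) * (|c x| * |d x| ^ σ)) (volume.restrict Ω) := i2.add i3
  have h1 := norm_integral_le_of_norm_le (i1.add i23) (Eventually.of_forall hpt)
  rw [Real.norm_eq_abs] at h1
  refine h1.trans ?_
  simp only [Pi.add_apply]
  rw [integral_add i1 i23, integral_add i2 i3, integral_const_mul, integral_const_mul,
    integral_const_mul, integral_const_mul, integral_add hci.abs iy]
  have g1 : A * (2 * t) * (2 ^ r * (cI + ∫ x in Ω, |c x| * |y x| ^ r)) ≤ ε / 3 := by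
    refine le_trans ?_ htε
    have h2 : ∫ x in Ω, |c x| * |y x| ^ r ≤ nc * (S * M ^ r) := by
      refine ey.trans ?_
      gcongr
    calc _ ≤ A * (2 * t) * (2 ^ r * (cI + nc * (S * M ^ r))) := by gcongr
      _ = _ := by rw [hB₁]; ring
  have g2 : T * L ^ (r - r') * ∫ x in Ω, |c x| * |d x| ^ r' ≤ ε / 3 := by
    refine le_trans ?_ hLε
    have h2 : ∫ x in Ω, |c x| * |d x| ^ r' ≤ B₂ := by
      refine ed'.trans ?_
      have : 0 ≤ r' := by linarith
      rw [hB₂]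
      gcongr
    rw [← mul_assoc]
    gcongr
  have g3 : T * L ^ (r - σ) * ∫ x in Ω, |c x| * |d x| ^ σ ≤ ε / 3 := by
    refine le_trans ?_ hθε
    have h2 : ∫ x in Ω, |c x| * |d x| ^ σ ≤ nc * θ ^ σ := by
      refine eσ.trans ?_
      have := hdθ.le
      gcongr
    rw [← mul_assoc]
    gcongr
  linarith

theorem exists_norm_sub_rpow_le_integral {τ M : ℝ} (hτ : 0 < τ) (hM : 0 ≤ M) :
    ∃ C ≥ 0, ∀ u v : W0 Ω p, ‖u‖ ≤ M → ‖v‖ ≤ M →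
      ‖u - v‖ ^ p ≤ τ + C * ∫ x in Ω, pMonotone p (grad u x) (grad v x) := by
  have hp1 : 1 < p := Fact.out
  have hp0 : 0 < p := by linarith
  have hε : 0 < τ / (2 * (M ^ p + 1)) := by positivity
  obtain ⟨C, hC, h⟩ := exists_norm_sub_rpow_le (E := EuclideanSpace ℝ (Fin N)) hp1 hε
  refine ⟨C, hC, fun u v hu hv => ?_⟩
  have iT := (integral_pMonotone_eq u v).1
  have i1 : Integrable (fun x => ‖grad u x‖ ^ p + ‖grad v x‖ ^ p) (volume.restrict Ω) :=
    (integrable_norm_grad_rpow u).add (integrable_norm_grad_rpow v)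
  have h1 : ∫ x in Ω, ‖grad (u - v) x‖ ^ p ≤
      ∫ x in Ω, (τ / (2 * (M ^ p + 1)) * (‖grad u x‖ ^ p + ‖grad v x‖ ^ p) +
        C * pMonotone p (grad u x) (grad v x)) := by
    refine integral_mono_ae (integrable_norm_grad_rpow (u - v))
      ((i1.const_mul _).add (iT.const_mul C)) ?_
    filter_upwards [grad_sub u v] with x hx
    rw [hx]
    exact h _ _
  rw [integral_add (i1.const_mul _) (iT.const_mul C), integral_const_mul, integral_const_mul,
    integral_add (integrable_norm_grad_rpow u) (integrable_norm_grad_rpow v),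
    integral_norm_grad_rpow, integral_norm_grad_rpow, integral_norm_grad_rpow] at h1
  have h2 : ‖u‖ ^ p ≤ M ^ p := Real.rpow_le_rpow (norm_nonneg _) hu hp0.le
  have h3 : ‖v‖ ^ p ≤ M ^ p := Real.rpow_le_rpow (norm_nonneg _) hv hp0.le
  have h4 : τ / (2 * (M ^ p + 1)) * (‖u‖ ^ p + ‖v‖ ^ p) ≤ τ := by
    have hMp : 0 ≤ M ^ p := by positivity
    calc _ ≤ τ / (2 * (M ^ p + 1)) * (2 * (M ^ p + 1)) := by
          gcongr
          linarith
      _ = τ := by field_simp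
  linarith

/-- Testing I'(u_i) and I'(u_j) with u_i - u_j bounds the monotone pairing of the two gradients,
hence ‖u_i - u_j‖. A Cauchy argument and completeness replace identification of a weak limit. -/
theorem exists_tendsto_subseq_of_bounded {q μ k r r' A M : ℝ} (hq : 0 < q) (hμ : 0 < μ)
    (hk : N / p < k) (hpr : p ≤ r) (hrr' : r < r')
    (hr'k : r' * (1 / p - 1 / N) ≤ 1 - 1 / k) (hA : 0 ≤ A)
    (hgA : ∀ s, |gFun p q μ s| ≤ A * (1 + |s| ^ (r - 1)))
    (hfA : ∀ s, |fFun p μ s| ≤ A * (1 + |s| ^ (r - 1)))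
    {c h : EuclideanSpace ℝ (Fin N) → ℝ}
    (hc : MemLp c (ENNReal.ofReal k) (volume.restrict Ω))
    (hh : MemLp h (ENNReal.ofReal k) (volume.restrict Ω)) {u : ℕ → W0 Ω p}
    (hu : ∀ n, ‖u n‖ ≤ M) (hd : ∀ n, DifferentiableAt ℝ (energy Ω p q μ c h) (u n))
    (hlim : Tendsto (fun n => ‖fderiv ℝ (energy Ω p q μ c h) (u n)‖) atTop (𝓝 0)) :
    ∃ (w : W0 Ω p) (σ : ℕ → ℕ), StrictMono σ ∧ Tendsto (u ∘ σ) atTop (𝓝 w) := by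
  have hp1 : 1 < p := Fact.out
  have hp0 : 0 < p := by linarith
  have hD : 0 < 1 / p - 1 / (N : ℝ) := sub_pos.2 (one_div_lt_one_div_of_lt hp0 hpN.out)
  have hk1 : 1 < k := one_lt_of_div_lt hp1 hpN.out hk
  have := isFiniteMeasure_restrict hb.out
  have hk1' : (1 : ℝ≥0∞) ≤ ENNReal.ofReal k := ENNReal.one_le_ofReal.2 hk1.le
  have hci := hc.integrable hk1'
  have hhi := hh.integrable hk1'
  have hM : 0 ≤ M := (norm_nonneg _).trans (hu 0)
  obtain ⟨S, -, hS⟩ := exists_integral_weight_le (Ω := Ω) (p := p) hk (r := r) (by linarith)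
    (le_trans (mul_le_mul_of_nonneg_right hrr'.le hD.le) hr'k)
  obtain ⟨σ, hσ, hcau⟩ := exists_subseq_cauchySeq_toLp hu
  suffices hcs : CauchySeq (u ∘ σ) by
    obtain ⟨w, hw⟩ := cauchySeq_tendsto_of_complete hcs
    exact ⟨w, σ, hσ, hw⟩
  rw [Metric.cauchySeq_iff]
  intro ε hε
  obtain ⟨C, hC, hmono⟩ := exists_norm_sub_rpow_le_integral (Ω := Ω) (p := p)
    (τ := ε ^ p / 2) (by positivity) hM
  -- I' and the two lower order terms contribute κ each, for both i and j, so 6κ in all; then 6Cκ <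
  -- ε^p/2, and the other half of ε^p is τ.
  set κ := ε ^ p / (16 * (C + 1)) with hκ
  have hκ0 : 0 < κ := by positivity
  obtain ⟨θ₁, hθ₁, H₁⟩ := exists_abs_integral_mul_le hk hpr hrr' hr'k hA hc hM hκ0
  obtain ⟨θ₂, hθ₂, H₂⟩ := exists_abs_integral_mul_le hk hpr hrr' hr'k hA hh hM hκ0
  obtain ⟨n₁, hn₁⟩ := Metric.cauchySeq_iff.1 hcau (min θ₁ θ₂) (lt_min hθ₁ hθ₂)
  have hlim' : Tendsto (fun n => ‖fderiv ℝ (energy Ω p q μ c h) (u (σ n))‖ * (2 * M)) atTop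
      (𝓝 0) := by
    simpa using (hlim.comp hσ.tendsto_atTop).mul_const (2 * M)
  obtain ⟨n₂, hn₂⟩ := eventually_atTop.1 (hlim'.eventually_le_const hκ0)
  refine ⟨max n₁ n₂, fun i hi j hj => ?_⟩
  have hi₁ := (le_max_left _ _).trans hi
  have hi₂ := (le_max_right _ _).trans hi
  have hj₁ := (le_max_left _ _).trans hj
  have hj₂ := (le_max_right _ _).trans hj
  set a := u (σ i) with ha
  set b := u (σ j) with hbdef
  have haM : ‖a‖ ≤ M := hu _
  have hbM : ‖b‖ ≤ M := hu _
  have hdM : ‖a - b‖ ≤ 2 * M := (norm_sub_le a b).trans (by linarith)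
  have hdθ : ‖toLp (a - b)‖ < min θ₁ θ₂ := by
    have := hn₁ i hi₁ j hj₁
    rwa [dist_eq_norm, ← map_sub] at this
  have key : ∀ n, n₂ ≤ n → |∫ x in Ω, ‖grad (u (σ n)) x‖ ^ (p - 2) *
      inner ℝ (grad (u (σ n)) x) (grad (a - b) x)| ≤ 3 * κ := by
    intro n hn
    have e := fderiv_energy_apply hq hμ (by linarith) hA hgA hfA hci hhi
      (fun v => (hS c hc v).1) (fun v => (hS h hh v).1) (hd (σ n)) (a - b)
    have e1 := H₁ _ hgA (u (σ n)) (a - b) (hu _) hdM (hdθ.trans_le (min_le_left _ _))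
    have e2 := H₂ _ hfA (u (σ n)) (a - b) (hu _) hdM (hdθ.trans_le (min_le_right _ _))
    have e3 : |fderiv ℝ (energy Ω p q μ c h) (u (σ n)) (a - b)| ≤ κ := by
      have := (fderiv ℝ (energy Ω p q μ c h) (u (σ n))).le_opNorm (a - b)
      rw [Real.norm_eq_abs] at this
      exact (this.trans (by gcongr)).trans (hn₂ n hn)
    rw [abs_le] at e1 e2 e3 ⊢
    constructor <;> linarith [e1.1, e1.2, e2.1, e2.2, e3.1, e3.2]
  have h1 := hmono a b haM hbM
  rw [(integral_pMonotone_eq a b).2] at h1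
  have h2 := (abs_le.1 (key i hi₂)).2
  have h3 := (abs_le.1 (key j hj₂)).1
  have h4 : C * ((∫ x in Ω, ‖grad a x‖ ^ (p - 2) * inner ℝ (grad a x) (grad (a - b) x)) -
      ∫ x in Ω, ‖grad b x‖ ^ (p - 2) * inner ℝ (grad b x) (grad (a - b) x)) ≤
      C * (6 * κ) := by
    gcongr
    linarith
  have h5 : C * (6 * κ) < ε ^ p / 2 := by
    have hεp : 0 < ε ^ p := by positivity
    have h6 : (C + 1) * (6 * κ) = 6 * ε ^ p / 16 := by
      rw [hκ]
      field_simp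
    nlinarith
  have h7 : ‖a - b‖ ^ p < ε ^ p := by linarith
  rw [dist_eq_norm]
  exact (Real.rpow_lt_rpow_iff (norm_nonneg _) hε.le hp0).1 h7

end W0

end

/-! ### The Palais–Smale condition at the mountain pass level -/

theorem lemma3p2 (N : ℕ) (hN : 3 ≤ N) (Ω : Set (EuclideanSpace ℝ (Fin N)))
    (hΩ : IsOpen Ω) [Fact (Bornology.IsBounded Ω)]
    (p : ℝ) [Fact (1 < p)] [Fact (p < N)]
    (q : ℝ) (hq : 0 < q) (μ : ℝ) (hμ : 0 < μ) (k : ℝ) (hk : N / p < k) :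
    ∃ δ : ℝ, 0 < δ ∧ ∀ c h : EuclideanSpace ℝ (Fin N) → ℝ,
      MemLp c (ENNReal.ofReal k) (volume.restrict Ω) →
      MemLp h (ENNReal.ofReal k) (volume.restrict Ω) →
      (∀ᵐ x ∂(volume.restrict Ω), 0 ≤ c x) →
      ¬ (∀ᵐ x ∂(volume.restrict Ω), c x = 0) →
      eLpNorm c (ENNReal.ofReal k) (volume.restrict Ω) ≤ ENNReal.ofReal δ →
      eLpNorm h (ENNReal.ofReal k) (volume.restrict Ω) ≤ ENNReal.ofReal δ →
      ∀ v₀ : W0 Ω p, IsMountainPassEndpoint (energy Ω p q μ c h) v₀ →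
        (∀ u : ℕ → W0 Ω p,
          IsPalaisSmaleSeq (energy Ω p q μ c h)
            (mountainPassLevel (energy Ω p q μ c h) v₀) u →
          ∃ M : ℝ, ∀ n, ‖u n‖ ≤ M) ∧
        PalaisSmaleCondition (energy Ω p q μ c h)
          (mountainPassLevel (energy Ω p q μ c h) v₀) := by
  have hp1 : 1 < p := Fact.out
  have hp0 : 0 < p := by linarith
  have hpN : p < N := Fact.out
  obtain ⟨η, hη, hηk, hηp⟩ := exists_subcritical_exponent hp1 hpN hk
  have hD : 0 < 1 / p - 1 / (N : ℝ) := sub_pos.2 (one_div_lt_one_div_of_lt hp0 hpN)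
  -- The growth of g is taken with 3η, so that r = p + 3η stays strictly below r' = p + 4η in the
  -- compactness step.
  obtain ⟨A₁, hA₁, hg⟩ := exists_abs_gFun_le hp1 hq hμ (η := 3 * η) (by linarith)
  obtain ⟨A₂, hA₂, hf⟩ := exists_abs_fFun_le hp1 hμ
  have hgA : ∀ s, |gFun p q μ s| ≤ (A₁ + 2 * A₂) * (1 + |s| ^ (p + 3 * η - 1)) := fun s => by
    have h1 := hg s
    rw [show p - 1 + 3 * η = p + 3 * η - 1 by ring] at h1
    have h2 : 0 ≤ |s| ^ (p + 3 * η - 1) := by positivity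
    refine h1.trans ?_
    gcongr
    linarith
  have hfA : ∀ s, |fFun p μ s| ≤ (A₁ + 2 * A₂) * (1 + |s| ^ (p + 3 * η - 1)) := fun s => by
    have h1 := Real.rpow_le_one_add_rpow (abs_nonneg s) (by linarith : 0 ≤ p - 1)
      (by linarith : p - 1 ≤ p + 3 * η - 1)
    have h2 : 0 ≤ |s| ^ (p + 3 * η - 1) := by positivity
    calc |fFun p μ s| ≤ A₂ * (1 + |s| ^ (p - 1)) := hf s
      _ ≤ A₂ * (2 * (1 + |s| ^ (p + 3 * η - 1))) := by gcongr; linarith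
      _ = 2 * A₂ * (1 + |s| ^ (p + 3 * η - 1)) := by ring
      _ ≤ _ := by gcongr; linarith
  -- F carries no logarithm and grows with the exact power p, which is why its term can be absorbed
  -- when h is small.
  have hF : ∀ s, |FFun p μ s| ≤ 2 * A₂ * (1 + |s| ^ p) := fun s => by
    have h1 := abs_primitive_le (by linarith) hA₂ hf s
    rwa [sub_add_cancel] at h1
  obtain ⟨S, hS, hSP⟩ := W0.exists_integral_weight_le (Ω := Ω) (p := p) hk hp0
    (le_trans (mul_le_mul_of_nonneg_right (by linarith) hD.le) hηk)
  -- With ‖h‖_k ≤ δ, the order-p part of the h-term is at most 2A₂ δ S ‖v‖^p ≤ ‖v‖^p/(2p); the added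
  -- 1 keeps the denominator positive.
  refine ⟨1 / (2 * p * (2 * A₂ * S + 1)), by positivity, ?_⟩
  intro c h hc hh hc0 _ _ hδ v₀ _
  have hbound : ∀ u : ℕ → W0 Ω p, IsPalaisSmaleSeq (energy Ω p q μ c h)
      (mountainPassLevel (energy Ω p q μ c h) v₀) u → ∃ M : ℝ, ∀ n, ‖u n‖ ≤ M := by
    rintro u ⟨hE, hd, hE'⟩
    obtain ⟨B₁, hB₁⟩ := hE.abs.bddAbove_range
    obtain ⟨B₂, hB₂⟩ := hE'.bddAbove_range
    obtain ⟨M, hM⟩ := W0.exists_norm_le_of_energy_le (Ω := Ω) (p := p) (AF := 2 * A₂) hq hμ hk hη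
      hηk hηp (by positivity) (by positivity) hgA hfA hF hc hh hc0 (fun v => by
        refine ⟨(hSP h hh v).1, ?_⟩
        have h1 : (eLpNorm h (ENNReal.ofReal k) (volume.restrict Ω)).toReal ≤
            1 / (2 * p * (2 * A₂ * S + 1)) :=
          ENNReal.toReal_le_of_le_ofReal (by positivity) hδ
        calc _ ≤ 2 * A₂ * ((eLpNorm h (ENNReal.ofReal k) (volume.restrict Ω)).toReal *
              (S * ‖v‖ ^ p)) := by
              gcongr
              exact (hSP h hh v).2
          _ ≤ 2 * A₂ * (1 / (2 * p * (2 * A₂ * S + 1)) * (S * ‖v‖ ^ p)) := by gcongr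
          _ = 1 / (2 * p) * ‖v‖ ^ p * (2 * A₂ * S / (2 * A₂ * S + 1)) := by
              field_simp
          _ ≤ _ := by
              refine mul_le_of_le_one_right (by positivity) ?_
              rw [div_le_one (by positivity)]
              linarith) (max B₁ B₂)
    exact ⟨M, fun n => hM (u n) (hd n) ((hB₁ ⟨n, rfl⟩).trans (le_max_left _ _))
      ((hB₂ ⟨n, rfl⟩).trans (le_max_right _ _))⟩
  refine ⟨hbound, fun u hu => ?_⟩
  obtain ⟨M, hM⟩ := hbound u hu
  exact W0.exists_tendsto_subseq_of_bounded hq hμ hk (by linarith : p ≤ p + 3 * η)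
    (by linarith : p + 3 * η < p + 4 * η) hηk (by positivity) hgA hfA hc hh hM hu.2.1 hu.2.2
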